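/- Let $V=\mathbb{C}\mathbf{1}\oplus\mathbb{C}X$ be the graded vector space with $\deg\mathbf 1=1$, $\deg X=-1$, with merge map $m(\mathbf 1\otimes\mathbf 1)=\mathbf 1$, $m(\mathbf 1\otimes X)=m(X\otimes \mathbf 1)=X$, $m(X\otimes X)=0$ and split map $\delta(\mathbf 1)=\mathbf 1\otimes X+X\otimes\mathbf 1$, $\delta(X)=X\otimes X$. For a link diagram $D$ with ordered crossings, the Khovanov bracket is the complex which in homological degree $i$ is the direct sum of $V^{\otimes \ell(r)}$ over all resolutions $r$ of $D$ with exactly $i$ one-smoothings, where $\ell(r)$ is the number of loops of $r$, with the quantum grading shifted up by $i$; its differential is the sum, over all changes of one smoothing from $0$ to $1$, of the maps $m$ or $\delta$ on the loops involved, with the sign $(-1)^{\#\{\text{one-smoothings at earlier crossings}\}}$. For $n\ge 1$ let $TU_n$ be the diagram of the unknot with $n$ crossings that is obtained from the vertical two-strand braid $\sigma^n$ (the strand from bottom right to top left being the upper one at each crossing) by joining its two top ends and joining its two bottom ends. It has $n+1$ loops in its all-zero resolution. Write $W\{s\}$ for the graded space $W$ with all degrees raised by $s$. Order the basis of $V\otimes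 V$ as $XX,\ X\mathbf 1,\ \mathbf 1X,\ \mathbf 1\mathbf 1$ and the basis of $V$ as $X,\ \mathbf 1$, let matrices act on column vectors, and put $$A=\begin{pmatrix}0&1&-1&0\\0&0&0&-1\\0&0&0&1\\0&0&0&0\end{pmatrix},\qquad B=\begin{pmatrix}0&1&1&0\\0&0&0&1\\0&0&0&1\\0&0&0&0\end{pmatrix},\qquad M=\begin{pmatrix}0&0\\1&0\\1&0\\0&1\end{pmatrix}^{T}.$$ **Proposition (Gap Reduction).** For every $n\ge1$, the Khovanov bracket of $TU_n$ is a complex of graded vector spaces, and it is homotopy equivalent, by degree-preserving chain maps and homotopies, to the complex $R_n$ $$V^{\otimes2}\{1-n\}\to V^{\otimes2}\{3-n\}\to\cdots\to V^{\otimes2}\{n-5\}\xrightarrow{B}V^{\otimes2}\{n-3\}\xrightarrow{A}V^{\otimes2}\{n-1\}\xrightarrow{M}V\{n\}$$ in homological degrees $0,\dots,n$, in which the last differential is $M$ and the differentials before it are, from right to left, alternately $A,B,A,\dots$ (for $n=1$ only $M$ occurs). Let $\Delta_k=d_k^\dagger d_k+d_{k-1}d_{k-1}^\dagger$ be the Laplacians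 of $R_n$, for the inner products in which the bases above are orthonormal. If $n\ge2$, then $\Delta_0$ is $\mathrm{Diag}(2,2,0,0)$ in a suitable orthonormal basis of $V\otimes V$, and in the ordered bases above $\Delta_{n-j}=\mathrm{Diag}(2,2,2,2)$ for $1<j<n$ and $\Delta_{n-1}=\mathrm{Diag}(2,2,2,1)$. For every $n\ge1$, $\Delta_n=\mathrm{Diag}(2,1)$. Consequently, for every $n\ge 1$ and every $0\le k\le n$, the spectral gap of $R_n$ in degree $k$, that is, the smallest non-zero eigenvalue of $\Delta_k$, is at least $1$. -/

import Mathlib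

open CategoryTheory

/-! ### Finite-dimensional graded spaces with a distinguished basis -/

/-- A sequence `C⁰ → C¹ → C² → ⋯` of finite-dimensional complex Hilbert spaces, each one given by an
orthonormal basis `basis k`; every basis vector has a quantum degree `qdeg`, and `d k` is the matrix
of the map `Cᵏ → Cᵏ⁺¹` (columns are the images of the basis vectors). -/
structure BasedSequence where
  basis : ℕ → Type
  fintypeBasis : ∀ k, Fintype (basis k)
  decEqBasis : ∀ k, DecidableEq (basis k)
  qdeg : ∀ k, basis k → ℤ
  d : ∀ k, Matrix (basis (k + 1)) (basis k) ℂ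

namespace BasedSequence

instance (S : BasedSequence) (k : ℕ) : Fintype (S.basis k) := S.fintypeBasis k

instance (S : BasedSequence) (k : ℕ) : DecidableEq (S.basis k) := S.decEqBasis k

/-- The chain space in homological degree `k`. -/
abbrev space (S : BasedSequence) (k : ℕ) : Type := S.basis k → ℂ

/-- The part of quantum degree `j` of the chain space in homological degree `k`. -/
def qPart (S : BasedSequence) (k : ℕ) (j : ℤ) : Submodule ℂ (S.space k) where
  carrier := {v | ∀ a, S.qdeg k a ≠ j → v a = 0}
  add_mem' := by
    intro u v hu hv a ha
    simp [hu a ha, hv a ha]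
  zero_mem' := by
    intro a _
    rfl
  smul_mem' := by
    intro c v hv a ha
    simp [hv a ha]

/-- A map between chain spaces that preserves the quantum degree. -/
def PreservesDegree {S T : BasedSequence} {k l : ℕ} (f : S.space k → T.space l) : Prop :=
  ∀ j : ℤ, ∀ v ∈ S.qPart k j, f v ∈ T.qPart l j

/-- `S` is a cochain complex of graded vector spaces: `d ∘ d = 0`, and `d` preserves the quantum
degree. -/
structure IsComplex (S : BasedSequence) : Prop where
  d_mul_d : ∀ k, S.d (k + 1) * S.d k = 0
  preserves : ∀ k, PreservesDegree (S := S) (T := S) (k := k) (l := k + 1)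
    (Matrix.toLin' (S.d k))

/-- The cochain complex of complex vector spaces given by `S`. -/
noncomputable def toCochainComplex (S : BasedSequence) (h : S.IsComplex) :
    CochainComplex (ModuleCat.{0} ℂ) ℕ :=
  CochainComplex.of (fun k => ModuleCat.of ℂ (S.space k))
    (fun k => ModuleCat.ofHom (Matrix.toLin' (S.d k)))
    (fun k => by
      rw [← ModuleCat.ofHom_comp, ← Matrix.toLin'_mul, h.d_mul_d k, map_zero]
      rfl)

/-- Homotopy equivalence of complexes of graded vector spaces: the two chain maps and the two
homotopies preserve the quantum degree. -/
def GradedHomotopyEquivalent (S T : BasedSequence) (hS : S.IsComplex) (hT : T.IsComplex) : Prop :=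
  ∃ e : HomotopyEquiv (S.toCochainComplex hS) (T.toCochainComplex hT),
    (∀ k, PreservesDegree (S := S) (T := T) (k := k) (l := k) (e.hom.f k).hom) ∧
    (∀ k, PreservesDegree (S := T) (T := S) (k := k) (l := k) (e.inv.f k).hom) ∧
    (∀ k l, PreservesDegree (S := S) (T := S) (k := k) (l := l) (e.homotopyHomInvId.hom k l).hom) ∧
    (∀ k l, PreservesDegree (S := T) (T := T) (k := k) (l := l) (e.homotopyInvHomId.hom k l).hom)

/-- The Laplacian `Δ_k = d_k† d_k + d_{k-1} d_{k-1}†` (with `d_{-1} = 0`), as a matrix in the given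
orthonormal basis. -/
noncomputable def laplacian (S : BasedSequence) :
    (k : ℕ) → Matrix (S.basis k) (S.basis k) ℂ
  | 0 => (S.d 0).conjTranspose * S.d 0
  | k + 1 => (S.d (k + 1)).conjTranspose * S.d (k + 1) + S.d k * (S.d k).conjTranspose

/-- `δ` is the spectral gap in homological degree `k`: the smallest non-zero eigenvalue of the
(Hermitian, positive semidefinite) Laplacian `Δ_k`. -/
def IsSpectralGap (S : BasedSequence) (k : ℕ) (δ : ℝ) : Prop :=
  IsLeast {μ : ℝ | μ ≠ 0 ∧ Module.End.HasEigenvalue (Matrix.toLin' (S.laplacian k)) (μ : ℂ)} δ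

end BasedSequence

/-! ### The Frobenius algebra `V` -/

/-- The two basis vectors `𝟏` and `X` of `V`. -/
inductive KhLabel : Type
  | one : KhLabel
  | X : KhLabel
  deriving DecidableEq

namespace KhLabel

instance : Fintype KhLabel := ⟨{one, X}, by intro x; cases x <;> simp⟩

/-- The degree: `deg 𝟏 = 1` and `deg X = -1`. -/
def deg : KhLabel → ℤ
  | one => 1
  | X => -1

/-- `mulCoeff x y z` is the coefficient of `z` in `m (x ⊗ y)`. -/
def mulCoeff : KhLabel → KhLabel → KhLabel → ℂ
  | one, one, one => 1
  | one, X, X => 1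
  | X, one, X => 1
  | _, _, _ => 0

/-- `comulCoeff x y z` is the coefficient of `y ⊗ z` in `δ x`. -/
def comulCoeff : KhLabel → KhLabel → KhLabel → ℂ
  | one, one, X => 1
  | one, X, one => 1
  | X, X, X => 1
  | _, _, _ => 0

end KhLabel

/-! ### The Khovanov bracket of a planar diagram -/

/-- A planar diagram code with `m` crossings and edge labels in `E`: the entry of a crossing is the
4-tuple `(a, b, c, d)` of the edges around it, read counterclockwise from the incoming lower strand
`a` (so `a`, `c` belong to the lower strand and `b`, `d` to the upper strand). -/
abbrev PDCode (m : ℕ) (E : Type) : Type := Fin m → Fin 4 → E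

namespace PDCode

variable {m : ℕ} {E : Type}

/-- The pairs of edges that are connected at some crossing in the resolution `r`: the
`0`-smoothing (`r k = false`) connects `(a, b)` and `(c, d)`, the `1`-smoothing connects `(a, d)`
and `(c, b)`. -/
def Joined (D : PDCode m E) (r : Fin m → Bool) (e e' : E) : Prop :=
  ∃ k, (r k = false ∧ ((e = D k 0 ∧ e' = D k 1) ∨ (e = D k 2 ∧ e' = D k 3))) ∨
    (r k = true ∧ ((e = D k 0 ∧ e' = D k 3) ∨ (e = D k 2 ∧ e' = D k 1)))

/-- The loops of the resolution `r`: the classes of edges for the equivalence relation generated by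
`Joined`. -/
def Loop (D : PDCode m E) (r : Fin m → Bool) : Type := Quot (D.Joined r)

/-- The loop of the resolution `r` on which the edge `e` lies. -/
def loopOf (D : PDCode m E) (r : Fin m → Bool) (e : E) : D.Loop r := Quot.mk _ e

instance [Finite E] (D : PDCode m E) (r : Fin m → Bool) : Finite (D.Loop r) :=
  inferInstanceAs (Finite (Quot (D.Joined r)))

/-- Hamming weight of a resolution. -/
def weight (r : Fin m → Bool) : ℕ := (Finset.univ.filter fun k => r k = true).card

/-- An enhanced state of homological degree `i`: a resolution `r` of weight `i`, and a label `𝟏` or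
`X` on each of its loops. These states are the standard basis of `⨁_{|r| = i} V^{⊗ ℓ(r)}`. -/
structure EnhancedState (D : PDCode m E) (i : ℕ) : Type where
  r : Fin m → Bool
  s : D.Loop r → KhLabel
  weight_eq : weight r = i

instance [Finite E] (D : PDCode m E) (i : ℕ) : Finite (D.EnhancedState i) :=
  Finite.of_injective
    (fun S : D.EnhancedState i => (⟨S.r, S.s⟩ : Σ r : Fin m → Bool, D.Loop r → KhLabel))
    (by
      rintro ⟨r, s, h⟩ ⟨r', s', h'⟩ heq
      cases heq
      rfl)

/-- The label of the loop through the edge `e`. -/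
def EnhancedState.label {D : PDCode m E} {i : ℕ} (S : D.EnhancedState i) (e : E) : KhLabel :=
  S.s (D.loopOf S.r e)

/-- Quantum degree `i + #{loops labelled 𝟏} - #{loops labelled X}`. -/
noncomputable def EnhancedState.qdeg {D : PDCode m E} {i : ℕ} (S : D.EnhancedState i) : ℤ :=
  (i : ℤ) + ∑ᶠ l : D.Loop S.r, (S.s l).deg

open Classical in
/-- The matrix entry from `S` to `T` of the part of the differential that changes the smoothing of
the crossing `k` from `0` to `1`. The loops of `S` that avoid the crossing keep their labels. The
loops of `S` through the crossing are those of the edges `a` and `c`: if they are one loop, it is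
split into the loops of `a` and `c` in `T`; otherwise, they are merged. The sign is
`(-1)^(number of 1-smoothings before k)`. -/
noncomputable def edgeCoeff (D : PDCode m E) {i j : ℕ} (S : D.EnhancedState i)
    (T : D.EnhancedState j) (k : Fin m) : ℂ :=
  if S.r k = false ∧ T.r = Function.update S.r k true ∧
      ∀ e, D.loopOf S.r e ≠ D.loopOf S.r (D k 0) → D.loopOf S.r e ≠ D.loopOf S.r (D k 2) →
        T.label e = S.label e then
    (-1) ^ (Finset.univ.filter fun l : Fin m => l < k ∧ T.r l = true).card *
      (if D.loopOf S.r (D k 0) = D.loopOf S.r (D k 2) then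
        KhLabel.comulCoeff (S.label (D k 0)) (T.label (D k 0)) (T.label (D k 2))
      else
        KhLabel.mulCoeff (S.label (D k 0)) (S.label (D k 2)) (T.label (D k 0)))
  else 0

/-- The Khovanov bracket of a diagram: in homological degree `i` it has the enhanced states of
degree `i` as its basis, and the differential is the signed sum over all changes of one smoothing
from `0` to `1` of the merge and split maps. -/
noncomputable def khovanovBracket [Finite E] (D : PDCode m E) : BasedSequence where
  basis := D.EnhancedState
  fintypeBasis := fun _ => Fintype.ofFinite _
  decEqBasis := fun _ => Classical.decEq _
  qdeg := fun _ S => S.qdeg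
  d := fun _ => Matrix.of fun T S => ∑ k, D.edgeCoeff S T k

end PDCode

/-- The diagram `TU_n` of the unknot, `n ≥ 1`: the vertical braid `σⁿ` on two strands, in which the
strand from bottom right to top left is the upper one at each crossing, with the two top ends joined
and the two bottom ends joined. Following the knot, the edges are `0, 1, …, 2n - 1` modulo `2n`:
`0` is the bottom arc, `n` is the top arc, `k` (on the way up) and `-k` (on the way down) are the two
edges between the crossings `k - 1` and `k`, for `0 < k < n`, with the crossings counted from `0` at
the bottom. The corners of crossing `k` (bottom left, bottom right, top right, top left) are
`k, -k, k + 1, -(k + 1)` for even `k` and `-k, k, -(k + 1), k + 1` for odd `k`; the lower strand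
enters at the bottom left for even `k` and at the top right for odd `k`. -/
def twistedUnknot (n : ℕ) : PDCode n (ZMod (2 * n)) := fun k =>
  let x : ZMod (2 * n) := ((k : ℕ) : ZMod (2 * n))
  if Even (k : ℕ) then ![x, -x, x + 1, -(x + 1)] else ![-(x + 1), x + 1, -x, x]

/-! ### The reduced complex -/

namespace ReducedTwist

/-- The ordered basis `XX, X𝟏, 𝟏X, 𝟏𝟏` of `V ⊗ V`. -/
def pairBasis : Fin 4 → KhLabel × KhLabel :=
  ![(KhLabel.X, KhLabel.X), (KhLabel.X, KhLabel.one), (KhLabel.one, KhLabel.X),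
    (KhLabel.one, KhLabel.one)]

/-- The ordered basis `X, 𝟏` of `V`. -/
def singleBasis : Fin 2 → KhLabel := ![KhLabel.X, KhLabel.one]

/-- The first of the two alternating differentials. -/
def dMinus : Matrix (Fin 4) (Fin 4) ℂ :=
  !![0, 1, -1, 0;
     0, 0, 0, -1;
     0, 0, 0, 1;
     0, 0, 0, 0]

/-- The second of the two alternating differentials. -/
def dPlus : Matrix (Fin 4) (Fin 4) ℂ :=
  !![0, 1, 1, 0;
     0, 0, 0, 1;
     0, 0, 0, 1;
     0, 0, 0, 0]

/-- The last differential `V ⊗ V → V`. -/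
def dLast : Matrix (Fin 2) (Fin 4) ℂ :=
  (!![0, 0;
      1, 0;
      1, 0;
      0, 1]).transpose

/-- The dimension of the chain space in degree `k`: `V ⊗ V` for `k < n`, `V` for `k = n`, and `0`
for `k > n`. -/
def dim (n k : ℕ) : ℕ := if k < n then 4 else if k = n then 2 else 0

theorem dim_of_lt {n k : ℕ} (h : k < n) : dim n k = 4 := by simp [dim, h]

theorem dim_of_eq {n k : ℕ} (h : k = n) : dim n k = 2 := by simp [dim, h]

/-- The complex
`V⊗V{1-n} → V⊗V{3-n} → ⋯ → V⊗V{n-3} → V⊗V{n-1} → V{n}` in the degrees `0, …, n`: the last map is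
`dLast`, and before it the maps are, from right to left, `dMinus`, `dPlus`, `dMinus`, … . -/
noncomputable def complex (n : ℕ) : BasedSequence where
  basis := fun k => Fin (dim n k)
  fintypeBasis := fun _ => inferInstance
  decEqBasis := fun _ => inferInstance
  qdeg := fun k i =>
    if h : k < n then
      let p := pairBasis (Fin.cast (dim_of_lt h) i)
      p.1.deg + p.2.deg + (2 * (k : ℤ) + 1 - n)
    else if h : k = n then
      (singleBasis (Fin.cast (dim_of_eq h) i)).deg + n
    else 0
  d := fun k =>
    if h : k + 1 < n then
      (if Even (n - k) then dMinus else dPlus).submatrix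
        (Fin.cast (dim_of_lt h)) (Fin.cast (dim_of_lt (Nat.lt_of_succ_lt h)))
    else if h : k + 1 = n then
      dLast.submatrix (Fin.cast (dim_of_eq h)) (Fin.cast (dim_of_lt (h ▸ Nat.lt_succ_self k)))
    else 0

/-- The Laplacian in degree `k < n` as a matrix in the ordered basis `XX, X𝟏, 𝟏X, 𝟏𝟏`. -/
noncomputable def pairLaplacian (n k : ℕ) (h : k < n) : Matrix (Fin 4) (Fin 4) ℂ :=
  ((complex n).laplacian k).submatrix (Fin.cast (dim_of_lt h).symm) (Fin.cast (dim_of_lt h).symm)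

/-- The Laplacian in degree `n` as a matrix in the ordered basis `X, 𝟏`. -/
noncomputable def lastLaplacian (n : ℕ) : Matrix (Fin 2) (Fin 2) ℂ :=
  ((complex n).laplacian n).submatrix (Fin.cast (dim_of_eq rfl).symm)
    (Fin.cast (dim_of_eq rfl).symm)

end ReducedTwist

/-! The all-zero resolution of `TU_n` is a stack of loops at levels 0, …, n, and the 1-smoothing of
crossing k glues the levels k and k + 1. So every edge of the cube is a merge; `δ` never occurs.
Adding one crossing on top replaces the complex C by the cone of C ⊗ V → C, where V acts through the
top loop of C. Since 𝟏 acts trivially, only the action of X on that loop has to be remembered: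
`XComplex` records it, `XComplex.twist` is the cone, and `codeComplex` iterates it from V.

A deformation retraction that commutes with X passes to cones (`Retract.twist`), so by induction
(`codeRetract`) it suffices to retract the cone over R_n to R_{n+1} (`reducedRetract`). In degrees
below n the cone contains a ⊗ b ⊗ c ↦ a ⊗ bc. The vectors a ⊗ 𝟏 ⊗ c cancel the target; what survives
is the kernel, spanned by a ⊗ (X ⊗ 𝟏 - 𝟏 ⊗ X)(𝟏 ⊗ c). Because X² = 0, multiplication of b by X acts
on this kernel as minus multiplication of c by X. Hence the differential "X on b, plus ε times X on
a" becomes, after rescaling by (-1)^k, "X on c, minus ε times X on a": this flip of ε is the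
alternation of A and B. The top term V of R_n contributes V ⊗ V in degree n and the merge to V,
which is the new last map.

The comparison with the bracket is combinatorial. `Code.D_single` writes the differential of the
iterated cone as a sum over crossings, `TwistedUnknot.edgeCoeff_eq` matches the summands with those
of the bracket, and `Realization.gradedHomotopyEquivalent` cuts the total spaces into homological
degrees.

For the Laplacians, consecutive differentials carry opposite signs ε, so their mixed terms cancel,
while X X† + X† X = 1 on each factor V; this gives 2 in the interior, and the ends are small matrix
computations. -/

/-! ### Complexes of graded spaces with an action of `X` -/

/-- A linear map between spaces of functions on bigraded sets which shifts the bidegree by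
`(i, j)`. -/
def IsHomogeneous {B B' : Type} (w : B → ℕ) (q : B → ℤ) (w' : B' → ℕ) (q' : B' → ℤ) (i j : ℤ)
    (f : (B → ℂ) →ₗ[ℂ] (B' → ℂ)) : Prop :=
  ∀ v b', (∀ b, (w b : ℤ) + i = w' b' → q b + j = q' b' → v b = 0) → f v b' = 0

theorem neg_one_pow_mul_self (n : ℕ) : (-1 : ℂ) ^ n * (-1) ^ n = 1 := by
  rw [← mul_pow]
  simp

/-- The operator `(-1)^w`. -/
def parity {B : Type} (w : B → ℕ) : (B → ℂ) →ₗ[ℂ] (B → ℂ) :=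
  LinearMap.pi fun b => (-1 : ℂ) ^ w b • LinearMap.proj b

@[simp] theorem parity_apply {B : Type} (w : B → ℕ) (v : B → ℂ) (b : B) :
    parity w v b = (-1) ^ w b * v b := rfl

namespace IsHomogeneous

variable {B B' B'' : Type} {w : B → ℕ} {q : B → ℤ} {w' : B' → ℕ} {q' : B' → ℤ}
  {w'' : B'' → ℕ} {q'' : B'' → ℤ} {i j i' j' : ℤ}
  {f f' : (B → ℂ) →ₗ[ℂ] (B' → ℂ)} {g : (B' → ℂ) →ₗ[ℂ] (B'' → ℂ)}

theorem comp (hg : IsHomogeneous w' q' w'' q'' i' j' g) (hf : IsHomogeneous w q w' q' i j f)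
    {a b : ℤ} (ha : i + i' = a) (hb : j + j' = b) :
    IsHomogeneous w q w'' q'' a b (g ∘ₗ f) := by
  intro v b'' hv
  refine hg _ _ fun b' h1 h2 => hf _ _ fun b h3 h4 => hv b ?_ ?_ <;> omega

theorem add (hf : IsHomogeneous w q w' q' i j f) (hf' : IsHomogeneous w q w' q' i j f') :
    IsHomogeneous w q w' q' i j (f + f') := by
  intro v b' hv
  simp [hf v b' hv, hf' v b' hv]

/-- A homogeneous map of even homological degree commutes with `(-1)^w`, one of odd degree
anticommutes with it. -/
theorem apply_parity (hf : IsHomogeneous w q w' q' i j f) (c : ℂ)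
    (hc : ∀ k l : ℕ, (k : ℤ) + i = l → (-1 : ℂ) ^ k = c * (-1) ^ l) (v : B → ℂ) :
    f (parity w v) = c • parity w' (f v) := by
  ext b'
  -- Every coordinate of `v` that can contribute to `b'` sits in one homological degree, where
  -- `parity` is a constant; the difference below vanishes on those coordinates, so `f` kills it at
  -- `b'`.
  have h := hf (parity w v - (c * (-1) ^ w' b') • v) b' fun b h1 _ => by
    simp [hc _ _ h1]
  rw [map_sub, map_smul, Pi.sub_apply, sub_eq_zero] at h
  simpa [mul_assoc] using h

theorem parity_zero (hf : IsHomogeneous w q w' q' 0 j f) (v : B → ℂ) :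
    f (parity w v) = parity w' (f v) := by
  simpa using hf.apply_parity 1 (by intro k l h; simp at h; simp [h]) v

theorem parity_one (hf : IsHomogeneous w q w' q' 1 j f) (v : B → ℂ) :
    f (parity w v) = -parity w' (f v) := by
  have := hf.apply_parity (-1) (by
    intro k l h
    obtain rfl : l = k + 1 := by omega
    ring) v
  simpa using this

theorem parity_neg_one (hf : IsHomogeneous w q w' q' (-1) j f) (v : B → ℂ) :
    f (parity w v) = -parity w' (f v) := by
  have := hf.apply_parity (-1) (by
    intro k l h
    obtain rfl : k = l + 1 := by omega
    ring) v
  simpa using this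

end IsHomogeneous

/-- A complex of graded spaces of functions on a bigraded set `B`, with an endomorphism `x` of
quantum degree `-2`. -/
structure XComplex (B : Type) where
  w : B → ℕ
  q : B → ℤ
  D : (B → ℂ) →ₗ[ℂ] (B → ℂ)
  x : (B → ℂ) →ₗ[ℂ] (B → ℂ)
  D_homogeneous : IsHomogeneous w q w q 1 0 D
  x_homogeneous : IsHomogeneous w q w q 0 (-2) x
  D_D : ∀ v, D (D v) = 0
  D_x : ∀ v, D (x v) = x (D v)
  x_x : ∀ v, x (x v) = 0

/-- The part of a function on `B × Option KhLabel` with a given second coordinate. -/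
def part {B : Type} (o : Option KhLabel) : (B × Option KhLabel → ℂ) →ₗ[ℂ] (B → ℂ) :=
  LinearMap.funLeft ℂ ℂ fun b => (b, o)

@[simp] theorem part_apply {B : Type} (o : Option KhLabel) (v : B × Option KhLabel → ℂ) (b : B) :
    part o v b = v (b, o) := rfl

/-- Assemble a map into functions on `B × Option KhLabel` from its three parts. -/
def assemble {B M : Type} [AddCommGroup M] [Module ℂ M] (f : Option KhLabel → M →ₗ[ℂ] (B → ℂ)) :
    M →ₗ[ℂ] (B × Option KhLabel → ℂ) :=
  LinearMap.pi fun p => LinearMap.proj p.1 ∘ₗ f p.2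

theorem ext_part {B : Type} {u v : B × Option KhLabel → ℂ} (h : ∀ o, part o u = part o v) :
    u = v := by
  ext ⟨b, o⟩
  exact congrFun (h o) b

/-- Apply a linear map to each of the three parts. -/
def mapParts {B B' : Type} (f : (B → ℂ) →ₗ[ℂ] (B' → ℂ)) :
    (B × Option KhLabel → ℂ) →ₗ[ℂ] (B' × Option KhLabel → ℂ) :=
  assemble fun o => f ∘ₗ part o

@[simp] theorem part_mapParts {B B' : Type} (f : (B → ℂ) →ₗ[ℂ] (B' → ℂ)) (o : Option KhLabel)
    (v : B × Option KhLabel → ℂ) : part o (mapParts f v) = f (part o v) := rfl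

/-- The homological degree of the cone `C ⊗ V → C`. -/
def twistWeight {B : Type} (w : B → ℕ) : B × Option KhLabel → ℕ
  | (b, some _) => w b
  | (b, none) => w b + 1

/-- The quantum degree of the cone `C ⊗ V → C`. -/
def twistDeg {B : Type} (q : B → ℤ) : B × Option KhLabel → ℤ
  | (b, some l) => q b + l.deg
  | (b, none) => q b + 1

theorem IsHomogeneous.mapParts {B B' : Type} {w : B → ℕ} {q : B → ℤ} {w' : B' → ℕ} {q' : B' → ℤ}
    {i j : ℤ} {f : (B → ℂ) →ₗ[ℂ] (B' → ℂ)} (hf : IsHomogeneous w q w' q' i j f) :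
    IsHomogeneous (twistWeight w) (twistDeg q) (twistWeight w') (twistDeg q') i j
      (mapParts f) := by
  rintro v ⟨b', o⟩ hv
  refine hf _ _ fun b h1 h2 => hv (b, o) ?_ ?_ <;> dsimp only at h1 h2 <;> cases o <;>
    simp [twistWeight, twistDeg] <;> omega

namespace XComplex

variable {B : Type}

/-- The differential of the cone `C ⊗ V → C` of the action map. -/
def twistD (C : XComplex B) : (B × Option KhLabel → ℂ) →ₗ[ℂ] (B × Option KhLabel → ℂ) :=
  assemble fun
    | some l => C.D ∘ₗ part (some l)
    -- The factor (-1)^w is the bracket's sign for the newest crossing, as all other 1-smoothings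
    -- come earlier in the order.
    | none => C.D ∘ₗ part none +
        parity C.w ∘ₗ (part (some .one) + C.x ∘ₗ part (some .X))

/-- The action of `X` on the last factor of the cone `C ⊗ V → C`. -/
def twistX (C : XComplex B) : (B × Option KhLabel → ℂ) →ₗ[ℂ] (B × Option KhLabel → ℂ) :=
  assemble fun
    | some .one => 0
    | some .X => part (some .one)
    | none => C.x ∘ₗ part none

@[simp] theorem part_some_twistD (C : XComplex B) (l : KhLabel) (v : B × Option KhLabel → ℂ) :
    part (some l) (C.twistD v) = C.D (part (some l) v) := rfl

@[simp] theorem part_none_twistD (C : XComplex B) (v : B × Option KhLabel → ℂ) :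
    part none (C.twistD v) =
      C.D (part none v) + parity C.w (part (some .one) v + C.x (part (some .X) v)) := rfl

@[simp] theorem part_one_twistX (C : XComplex B) (v : B × Option KhLabel → ℂ) :
    part (some .one) (C.twistX v) = 0 := rfl

@[simp] theorem part_X_twistX (C : XComplex B) (v : B × Option KhLabel → ℂ) :
    part (some .X) (C.twistX v) = part (some .one) v := rfl

@[simp] theorem part_none_twistX (C : XComplex B) (v : B × Option KhLabel → ℂ) :
    part none (C.twistX v) = C.x (part none v) := rfl

/-- The cone `C ⊗ V → C` of the action map. -/
def twist (C : XComplex B) : XComplex (B × Option KhLabel) where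
  w := twistWeight C.w
  q := twistDeg C.q
  D := C.twistD
  x := C.twistX
  D_homogeneous := by
    rintro v ⟨b', _ | l⟩ hv
    · have h1 : C.D (part none v) b' = 0 := C.D_homogeneous _ _ fun b h1 h2 =>
        hv (b, none) (by simp [twistWeight]; omega) (by simp [twistDeg]; omega)
      have h2 : C.x (part (some .X) v) b' = 0 := C.x_homogeneous _ _ fun b h1 h2 =>
        hv (b, some .X) (by simp [twistWeight]; omega) (by simp [twistDeg, KhLabel.deg]; omega)
      have h3 : v (b', some .one) = 0 :=
        hv _ (by simp [twistWeight]) (by simp [twistDeg, KhLabel.deg])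
      change (C.D (part none v) + parity C.w (part (some .one) v + C.x (part (some .X) v))) b' = 0
      simp [h1, h2, h3]
    · exact C.D_homogeneous _ _ fun b h1 h2 =>
        hv (b, some l) (by simpa [twistWeight] using h1) (by simp [twistDeg]; dsimp only at h2; omega)
  x_homogeneous := by
    rintro v ⟨b', _ | _ | _⟩ hv
    · exact C.x_homogeneous _ _ fun b h1 h2 =>
        hv (b, none) (by simpa [twistWeight] using h1) (by simp [twistDeg]; dsimp only at h2; omega)
    · rfl
    · exact hv (b', some .one) (by simp [twistWeight]) (by simp [twistDeg, KhLabel.deg]; omega)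
  -- The two mixed terms cancel because D has homological degree 1 and so anticommutes with (-1)^w.
  D_D := by
    intro v
    refine ext_part fun o => ?_
    cases o
    · simp [C.D_D, C.D_homogeneous.parity_one, C.D_x]
      abel
    · simp [C.D_D]
  -- At `none`, the twisted action followed by the merge and the merge followed by the action differ
  -- by a term in x², which is zero.
  D_x := by
    intro v
    refine ext_part fun o => ?_
    rcases o with _ | _ | _
    · simp [C.D_x, C.x_homogeneous.parity_zero, C.x_x]
    · simp
    · simp
  x_x := by
    intro v
    refine ext_part fun o => ?_
    rcases o with _ | _ | _ <;> simp [C.x_x]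

end XComplex

/-! ### Deformation retractions that commute with X. -/

/-- A strong deformation retraction `C → R`, homogeneous and compatible with the actions of `X`. -/
structure Retract {B B' : Type} (C : XComplex B) (R : XComplex B') where
  F : (B → ℂ) →ₗ[ℂ] (B' → ℂ)
  G : (B' → ℂ) →ₗ[ℂ] (B → ℂ)
  H : (B → ℂ) →ₗ[ℂ] (B → ℂ)
  F_homogeneous : IsHomogeneous C.w C.q R.w R.q 0 0 F
  G_homogeneous : IsHomogeneous R.w R.q C.w C.q 0 0 G
  H_homogeneous : IsHomogeneous C.w C.q C.w C.q (-1) 0 H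
  F_D : ∀ v, F (C.D v) = R.D (F v)
  G_D : ∀ v, G (R.D v) = C.D (G v)
  F_x : ∀ v, F (C.x v) = R.x (F v)
  G_x : ∀ v, G (R.x v) = C.x (G v)
  H_x : ∀ v, H (C.x v) = C.x (H v)
  F_G : ∀ v, F (G v) = v
  G_F : ∀ v, G (F v) = v + C.D (H v) + H (C.D v)

namespace Retract

variable {B B' B'' : Type} {C : XComplex B} {R : XComplex B'} {Q : XComplex B''}

/-- Composition of deformation retractions. -/
def comp (s : Retract R Q) (t : Retract C R) : Retract C Q where
  F := s.F ∘ₗ t.F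
  G := t.G ∘ₗ s.G
  H := t.H + t.G ∘ₗ s.H ∘ₗ t.F
  F_homogeneous := s.F_homogeneous.comp t.F_homogeneous rfl rfl
  G_homogeneous := t.G_homogeneous.comp s.G_homogeneous rfl rfl
  H_homogeneous := t.H_homogeneous.add
    (t.G_homogeneous.comp (s.H_homogeneous.comp t.F_homogeneous rfl rfl) rfl rfl)
  F_D := by simp [s.F_D, t.F_D]
  G_D := by simp [s.G_D, t.G_D]
  F_x := by simp [s.F_x, t.F_x]
  G_x := by simp [s.G_x, t.G_x]
  H_x := by simp [s.H_x, t.H_x, t.F_x, t.G_x]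
  F_G := by simp [s.F_G, t.F_G]
  G_F := by
    intro v
    simp only [LinearMap.comp_apply, LinearMap.add_apply, map_add, s.G_F, t.G_F, t.F_D, t.G_D]
    abel

/-- The cone construction preserves deformation retractions. -/
def twist (t : Retract C R) : Retract C.twist R.twist where
  F := mapParts t.F
  G := mapParts t.G
  H := mapParts t.H
  F_homogeneous := t.F_homogeneous.mapParts
  G_homogeneous := t.G_homogeneous.mapParts
  H_homogeneous := t.H_homogeneous.mapParts
  F_D := by
    intro v
    refine ext_part fun o => ?_
    cases o <;> simp [XComplex.twist, t.F_D, t.F_x, t.F_homogeneous.parity_zero]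
  G_D := by
    intro v
    refine ext_part fun o => ?_
    cases o <;> simp [XComplex.twist, t.G_D, t.G_x, t.G_homogeneous.parity_zero]
  F_x := by
    intro v
    refine ext_part fun o => ?_
    rcases o with _ | _ | _ <;> simp [XComplex.twist, t.F_x]
  G_x := by
    intro v
    refine ext_part fun o => ?_
    rcases o with _ | _ | _ <;> simp [XComplex.twist, t.G_x]
  H_x := by
    intro v
    refine ext_part fun o => ?_
    rcases o with _ | _ | _ <;> simp [XComplex.twist, t.H_x]
  F_G := by
    intro v
    refine ext_part fun o => ?_
    simp [t.F_G]
  -- The mixed terms of DH + HD cancel: H commutes with x and, having homological degree -1,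
  -- anticommutes with (-1)^w.
  G_F := by
    intro v
    refine ext_part fun o => ?_
    cases o
    · simp [XComplex.twist, t.G_F, t.H_x, t.H_homogeneous.parity_neg_one]
      abel
    · simp [XComplex.twist, t.G_F]

end Retract

/-- The complex `V` in degree `0`. -/
def baseComplex : XComplex KhLabel where
  w := fun _ => 0
  q := KhLabel.deg
  D := 0
  x := LinearMap.pi fun
    | .one => 0
    | .X => LinearMap.proj .one
  D_homogeneous := by
    intro v b _
    rfl
  x_homogeneous := by
    rintro v (_ | _) hv
    · rfl
    · exact hv .one (by simp) (by simp [KhLabel.deg])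
  D_D := by simp
  D_x := by simp
  x_x := by
    intro v
    ext (_ | _) <;> rfl

/-- A label for the lowest loop, and for every crossing either a label of the loop above it or
`none` if it is `1`-smoothed. -/
def Code : ℕ → Type
  | 0 => KhLabel
  | n + 1 => Code n × Option KhLabel

/-- The iterated cone. -/
def codeComplex : (n : ℕ) → XComplex (Code n)
  | 0 => baseComplex
  | n + 1 => (codeComplex n).twist

/-! ### The reduced complex as a complex with an action of `X` -/

/-- The basis of the reduced complex. -/
abbrev ReducedIndex (n : ℕ) : Type := (Fin n × KhLabel × KhLabel) ⊕ KhLabel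

namespace ReducedIndex

/-- The homological degree. -/
def w {n : ℕ} : ReducedIndex n → ℕ
  | .inl (k, _, _) => k
  | .inr _ => n

/-- The quantum degree. -/
def q {n : ℕ} : ReducedIndex n → ℤ
  | .inl (k, a, b) => a.deg + b.deg + (2 * (k : ℤ) + 1 - n)
  | .inr a => a.deg + n

/-- The coordinate at `a ⊗ b` in degree `k`; it is `0` unless `k < n`. -/
def coord {n : ℕ} (k : ℕ) (a b : KhLabel) : (ReducedIndex n → ℂ) →ₗ[ℂ] ℂ :=
  if h : k < n then LinearMap.proj (.inl (⟨k, h⟩, a, b)) else 0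

/-- The coordinate at `a ⊗ b` in degree `k - 1`; it is `0` unless `0 < k ≤ n`. -/
def prev {n : ℕ} : ℕ → KhLabel → KhLabel → (ReducedIndex n → ℂ) →ₗ[ℂ] ℂ
  | 0, _, _ => 0
  | k + 1, a, b => coord k a b

variable {n : ℕ}

theorem coord_of_lt {k : ℕ} (h : k < n) (a b : KhLabel) (v : ReducedIndex n → ℂ) :
    coord k a b v = v (.inl (⟨k, h⟩, a, b)) := by simp [coord, h]

@[simp] theorem prev_zero (a b : KhLabel) (v : ReducedIndex n → ℂ) : prev 0 a b v = 0 := rfl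

@[simp] theorem prev_succ (k : ℕ) (a b : KhLabel) (v : ReducedIndex n → ℂ) :
    prev (k + 1) a b v = coord k a b v := rfl

/-- The differential. -/
def D (n : ℕ) : (ReducedIndex n → ℂ) →ₗ[ℂ] (ReducedIndex n → ℂ) :=
  -- Below degree n this is 1 ⊗ X + ε X ⊗ 1 with ε = (-1)^(n + k), where k is the degree of the
  -- target. So ε is -1 for the map into degree n - 1 and alternates from there; into degree n the
  -- map is the merge.
  LinearMap.pi fun
    | .inl (_, .one, .one) => 0
    | .inl (k, .one, .X) => prev k .one .one
    | .inl (k, .X, .one) => (-1 : ℂ) ^ (n + k) • prev k .one .one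
    | .inl (k, .X, .X) => prev k .X .one + (-1 : ℂ) ^ (n + k) • prev k .one .X
    | .inr .one => prev n .one .one
    | .inr .X => prev n .one .X + prev n .X .one

/-- The action of `X` on the last factor. -/
def x (n : ℕ) : (ReducedIndex n → ℂ) →ₗ[ℂ] (ReducedIndex n → ℂ) :=
  LinearMap.pi fun
    | .inl (_, _, .one) => 0
    | .inl (k, a, .X) => coord k a .one
    | .inr .one => 0
    | .inr .X => LinearMap.proj (.inr .one)

section apply

variable (v : ReducedIndex n → ℂ) (k : Fin n) (a : KhLabel)

@[simp] theorem D_one_one : D n v (.inl (k, .one, .one)) = 0 := rfl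
@[simp] theorem D_one_X : D n v (.inl (k, .one, .X)) = prev k .one .one v := rfl
@[simp] theorem D_X_one :
    D n v (.inl (k, .X, .one)) = (-1) ^ (n + k) * prev k .one .one v := rfl
@[simp] theorem D_X_X : D n v (.inl (k, .X, .X)) =
    prev k .X .one v + (-1) ^ (n + k) * prev k .one .X v := rfl
@[simp] theorem D_inr_one : D n v (.inr .one) = prev n .one .one v := rfl
@[simp] theorem D_inr_X : D n v (.inr .X) = prev n .one .X v + prev n .X .one v := rfl
@[simp] theorem x_one : x n v (.inl (k, a, .one)) = 0 := rfl
@[simp] theorem x_X : x n v (.inl (k, a, .X)) = coord k a .one v := rfl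
@[simp] theorem x_inr_one : x n v (.inr .one) = 0 := rfl
@[simp] theorem x_inr_X : x n v (.inr .X) = v (.inr .one) := rfl

end apply

theorem coord_eq_zero {v : ReducedIndex n → ℂ} {k : ℕ} {a b : KhLabel}
    (h : ∀ hk : k < n, v (.inl (⟨k, hk⟩, a, b)) = 0) : coord k a b v = 0 := by
  by_cases hk : k < n
  · rw [coord_of_lt hk, h hk]
  · simp [coord, hk]

theorem prev_eq_zero {v : ReducedIndex n → ℂ} {k : ℕ} {a b : KhLabel}
    (h : ∀ j (hj : j < n), j + 1 = k → v (.inl (⟨j, hj⟩, a, b)) = 0) : prev k a b v = 0 := by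
  cases k with
  | zero => rfl
  | succ k => exact coord_eq_zero fun hk => h k hk rfl

end ReducedIndex

open ReducedIndex in
/-- The reduced complex. -/
def reducedComplex (n : ℕ) : XComplex (ReducedIndex n) where
  w := w
  q := q
  D := D n
  x := x n
  D_homogeneous := by
    rintro v (⟨k, _ | _, _ | _⟩ | _ | _) hv <;> simp
    all_goals
      try rw [prev_eq_zero]
      try rw [prev_eq_zero]
      all_goals first
        | done
        | (intro j hj hjk
           apply hv <;> simp [w, q, KhLabel.deg] <;> omega)
        | simp
  x_homogeneous := by
    rintro v (⟨k, a, _ | _⟩ | _ | _) hv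
    · rfl
    · exact coord_eq_zero fun hk => hv _ (by simp [w]) (by simp [q, KhLabel.deg]; omega)
    · rfl
    · exact hv _ (by simp [w]) (by simp [q, KhLabel.deg]; omega)
  -- Consecutive values of ε are opposite, so the mixed terms cancel and X² = 0 removes the rest; at
  -- the end, the merge kills the image of 1 ⊗ X - X ⊗ 1.
  D_D := by
    intro v
    ext b
    rcases b with ⟨⟨_ | _ | k, hk⟩, _ | _, _ | _⟩ | _ | _
    any_goals simp
    any_goals simp [coord_of_lt (Nat.zero_lt_of_lt hk)]
    any_goals simp [coord_of_lt (Nat.lt_of_succ_lt hk), pow_add]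
    all_goals
      obtain _ | _ | n := n <;> simp [coord_of_lt (Nat.lt_succ_self _), pow_add,
        neg_one_pow_mul_self]
  D_x := by
    intro v
    ext b
    rcases b with ⟨⟨_ | k, hk⟩, a⟩ | _ | _
    · rcases a with ⟨_ | _, _ | _⟩ <;> simp [coord_of_lt hk]
    · rcases a with ⟨_ | _, _ | _⟩ <;> simp [coord_of_lt hk, coord_of_lt (Nat.lt_of_succ_lt hk)]
    all_goals
      obtain _ | n := n <;> simp [coord_of_lt (Nat.lt_succ_self _)]
  x_x := by
    intro v
    ext b
    rcases b with ⟨k, _, _ | _⟩ | _ | _ <;> simp [coord_of_lt (Fin.is_lt _)]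

/-! ### Cancellation in the cone over the reduced complex. -/

namespace Reduction
open ReducedIndex

variable {n : ℕ}

/-- The projection of the cone over the reduced complex. -/
def F (n : ℕ) : (ReducedIndex n × Option KhLabel → ℂ) →ₗ[ℂ] (ReducedIndex (n + 1) → ℂ) :=
  LinearMap.pi fun
    -- The summand at `none` is the zigzag correction of the cancellation: a ⊗ c in degree k - 1 is
    -- lifted by `H` to a ⊗ 𝟏 ⊗ c with sign -(-1)^(k-1), and the differential moves 𝟏 to X (or, into
    -- degree n, merges it away). With the sign (-1)^k of the projection the coefficient is 1.
    | .inl (k, a, c) =>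
      (if (k : ℕ) < n then (-1 : ℂ) ^ (k : ℕ) • coord k a .X ∘ₗ part (some c)
        else (-1 : ℂ) ^ n • LinearMap.proj (.inr a) ∘ₗ part (some c)) + prev k a c ∘ₗ part none
    | .inr a => LinearMap.proj (.inr a) ∘ₗ part none

/-- The inclusion into the cone over the reduced complex. -/
def G (n : ℕ) : (ReducedIndex (n + 1) → ℂ) →ₗ[ℂ] (ReducedIndex n × Option KhLabel → ℂ) :=
  LinearMap.pi fun
    -- The image of a ⊗ c is (-1)^k a ⊗ (X ⊗ 𝟏 - 𝟏 ⊗ X)(𝟏 ⊗ c), in the kernel of the multiplication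
    -- of the last two factors; the correction -𝟏 ⊗ X is present only for c = 𝟏.
    | (.inl (k, a, .X), some c) => (-1 : ℂ) ^ (k : ℕ) • coord k a c
    | (.inl _, some .one) => 0
    | (.inl (k, a, .one), some .X) => -(-1 : ℂ) ^ (k : ℕ) • coord k a .one
    | (.inr a, some c) => (-1 : ℂ) ^ n • coord n a c
    | (.inl _, none) => 0
    | (.inr a, none) => LinearMap.proj (.inr a)

/-- The homotopy on the cone over the reduced complex. -/
def H (n : ℕ) : (ReducedIndex n × Option KhLabel → ℂ) →ₗ[ℂ]
    (ReducedIndex n × Option KhLabel → ℂ) :=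
  LinearMap.pi fun
    -- Minus the inverse of a ⊗ 𝟏 ⊗ c ↦ ± a ⊗ c. The unit stands in the middle factor and not in the
    -- last one, where X acts, so that the homotopy commutes with X.
    | (.inl (k, a, .one), some c) => -(-1 : ℂ) ^ (k : ℕ) • coord k a c ∘ₗ part none
    | (.inl (_, _, .X), _) => 0
    | (.inr _, _) => 0
    | (.inl _, none) => 0

section apply

variable (v : ReducedIndex n × Option KhLabel → ℂ) (u : ReducedIndex (n + 1) → ℂ) (a c : KhLabel)

theorem F_inl_of_lt {k : ℕ} (hk : k < n) (hk' : k < n + 1) : F n v (.inl (⟨k, hk'⟩, a, c)) =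
    (-1) ^ k * v (.inl (⟨k, hk⟩, a, .X), some c) + prev k a c (part none v) := by
  simp [F, hk, coord_of_lt hk]

@[simp] theorem F_inl_last (hk : n < n + 1) : F n v (.inl (⟨n, hk⟩, a, c)) =
    (-1) ^ n * v (.inr a, some c) + prev n a c (part none v) := by
  simp [F]

theorem F_inl_zero (hk : 0 < n) :
    F n v (.inl (0, a, c)) = v (.inl (⟨0, hk⟩, a, .X), some c) := by
  simpa using F_inl_of_lt v a c hk n.succ_pos

@[simp] theorem F_zero_inl (v : ReducedIndex 0 × Option KhLabel → ℂ) :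
    F 0 v (.inl (0, a, c)) = v (.inr a, some c) := by
  simpa using F_inl_last v a c Nat.one_pos

@[simp] theorem F_inr : F n v (.inr a) = v (.inr a, none) := rfl

@[simp] theorem G_X (k : Fin n) : G n u (.inl (k, a, .X), some c) = (-1) ^ (k : ℕ) * coord k a c u := rfl
@[simp] theorem G_one_one (k : Fin n) : G n u (.inl (k, a, .one), some .one) = 0 := rfl
@[simp] theorem G_one_X (k : Fin n) : G n u (.inl (k, a, .one), some .X) =
  -(-1) ^ (k : ℕ) * coord k a .one u := rfl
@[simp] theorem G_inr : G n u (.inr a, some c) = (-1) ^ n * coord n a c u := rfl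
@[simp] theorem G_none (k : Fin n × KhLabel × KhLabel) : G n u (.inl k, none) = 0 := by
  obtain ⟨_, _, _ | _⟩ := k <;> rfl
@[simp] theorem G_inr_none : G n u (.inr a, none) = u (.inr a) := rfl
@[simp] theorem prev_G (k : ℕ) : prev k a c (part none (G n u)) = 0 :=
  prev_eq_zero fun _ _ _ => G_none _ _
@[simp] theorem H_one (k : Fin n) : H n v (.inl (k, a, .one), some c) =
  -(-1) ^ (k : ℕ) * coord k a c (part none v) := rfl
@[simp] theorem H_X (k : Fin n) (o : Option KhLabel) : H n v (.inl (k, a, .X), o) = 0 := rfl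
@[simp] theorem H_inr (o : Option KhLabel) : H n v (.inr a, o) = 0 := rfl
@[simp] theorem H_none (k : Fin n × KhLabel × KhLabel) : H n v (.inl k, none) = 0 := by
  obtain ⟨_, _, _ | _⟩ := k <;> rfl

@[simp] theorem reducedComplex_w : (reducedComplex n).w = w := rfl
@[simp] theorem reducedComplex_D : (reducedComplex n).D = D n := rfl
@[simp] theorem reducedComplex_x : (reducedComplex n).x = x n := rfl
@[simp] theorem w_inl (k : Fin n) (p : KhLabel × KhLabel) : w (.inl (k, p)) = k := rfl
@[simp] theorem w_inr : w (.inr a : ReducedIndex n) = n := rfl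

@[simp] theorem prev_x_one (k : ℕ) (u : ReducedIndex n → ℂ) : prev k a .one (x n u) = 0 :=
  prev_eq_zero fun _ _ _ => rfl

@[simp] theorem prev_x_X (k : ℕ) (u : ReducedIndex n → ℂ) :
    prev k a .X (x n u) = prev k a .one u := by
  obtain _ | k := k
  · rfl
  · by_cases hk : k < n <;> simp [coord, hk]

@[simp] theorem twistD_some (b : ReducedIndex n) :
    (reducedComplex n).twistD v (b, some c) = D n (part (some c) v) b := rfl

@[simp] theorem twistD_none (b : ReducedIndex n) :
    (reducedComplex n).twistD v (b, none) = D n (part none v) b +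
      (-1) ^ w b * (v (b, some .one) + x n (part (some .X) v) b) := rfl

@[simp] theorem twistX_one (b : ReducedIndex n) :
    (reducedComplex n).twistX v (b, some .one) = 0 := rfl

@[simp] theorem twistX_X (b : ReducedIndex n) :
    (reducedComplex n).twistX v (b, some .X) = v (b, some .one) := rfl

@[simp] theorem twistX_none (b : ReducedIndex n) :
    (reducedComplex n).twistX v (b, none) = x n (part none v) b := rfl

end apply

end Reduction

open Reduction ReducedIndex in
/-- The cone over the reduced complex retracts to the next reduced complex. -/
def reducedRetract (n : ℕ) : Retract (reducedComplex n).twist (reducedComplex (n + 1)) where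
  F := F n
  G := G n
  H := H n
  F_homogeneous := by
    rintro v (⟨⟨k, hk⟩, a, c⟩ | a) hv
    · have h : prev k a c (part none v) = 0 := prev_eq_zero fun j hj hjk => hv _
        (by simp [twistWeight, XComplex.twist, reducedComplex, w]; omega)
        (by simp [twistDeg, XComplex.twist, reducedComplex, q]; omega)
      obtain hk' | rfl := Nat.lt_succ_iff_lt_or_eq.1 hk
      · rw [F_inl_of_lt _ _ _ hk', h, hv _ (by simp [twistWeight, XComplex.twist, reducedComplex, w])
          (by simp [twistDeg, XComplex.twist, reducedComplex, q, KhLabel.deg]; omega)]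
        simp
      · rw [F_inl_last, h, hv _ (by simp [twistWeight, XComplex.twist, reducedComplex, w])
          (by simp [twistDeg, XComplex.twist, reducedComplex, q, KhLabel.deg]; omega)]
        simp
    · exact hv _ (by simp [twistWeight, XComplex.twist, reducedComplex, w])
          (by simp [twistDeg, XComplex.twist, reducedComplex, q]; omega)
  G_homogeneous := by
    rintro v ⟨⟨⟨k, hk⟩, a, b⟩ | a, o⟩ hv
    · rcases o with _ | c
      · exact G_none _ _
      · rcases b with _ | _
        · rcases c with _ | _
          · rfl
          · rw [G_one_X, coord_eq_zero, mul_zero]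
            exact fun hk => hv _ (by simp [twistWeight, XComplex.twist, reducedComplex, w])
              (by simp [twistDeg, XComplex.twist, reducedComplex, q, KhLabel.deg]; omega)
        · rw [G_X, coord_eq_zero, mul_zero]
          exact fun hk => hv _ (by simp [twistWeight, XComplex.twist, reducedComplex, w])
            (by simp [twistDeg, XComplex.twist, reducedComplex, q, KhLabel.deg]; omega)
    · rcases o with _ | c
      · exact hv _ (by simp [twistWeight, XComplex.twist, reducedComplex, w])
            (by simp [twistDeg, XComplex.twist, reducedComplex, q]; omega)
      · rw [G_inr, coord_eq_zero, mul_zero]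
        exact fun hk => hv _ (by simp [twistWeight, XComplex.twist, reducedComplex, w])
            (by simp [twistDeg, XComplex.twist, reducedComplex, q]; omega)
  H_homogeneous := by
    rintro v ⟨⟨⟨k, hk⟩, a, b⟩ | a, o⟩ hv
    · rcases o with _ | c
      · exact H_none _ _
      · rcases b with _ | _
        · rw [H_one, coord_eq_zero, mul_zero]
          exact fun hk => hv _ (by simp [twistWeight, XComplex.twist, reducedComplex, w])
            (by simp [twistDeg, XComplex.twist, reducedComplex, q, KhLabel.deg]; omega)
        · rfl
    · rfl
  F_D := by
    intro v
    ext b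
    change F n ((reducedComplex n).twistD v) b = D (n + 1) (F n v) b
    rcases b with ⟨⟨_ | k, hk⟩, a, c⟩ | a
    · obtain hk' | rfl := Nat.lt_succ_iff_lt_or_eq.1 hk
      · rw [F_inl_of_lt _ _ _ hk']
        rcases a with _ | _ <;> rcases c with _ | _ <;> simp
      · rw [F_inl_last]
        rcases a with _ | _ <;> rcases c with _ | _ <;> simp
    · obtain hk' | rfl := Nat.lt_succ_iff_lt_or_eq.1 hk
      · have h := Nat.lt_of_succ_lt hk'
        rw [F_inl_of_lt _ _ _ hk']
        rcases a with _ | _ <;> rcases c with _ | _ <;>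
          simp [coord_of_lt h, coord_of_lt (Nat.lt_of_succ_lt hk), F_inl_of_lt _ _ _ h]
        all_goals
          -- Only the parities of n and k enter the remaining identities.
          obtain h1 | h1 := neg_one_pow_eq_or ℂ n <;> obtain h2 | h2 := neg_one_pow_eq_or ℂ k <;>
            simp [h1, h2, pow_add] <;> ring
      · rw [F_inl_last]
        rcases a with _ | _ <;> rcases c with _ | _ <;>
          simp [coord_of_lt (Nat.lt_of_succ_lt hk), coord_of_lt (Nat.lt_succ_self _),
            F_inl_of_lt _ _ _ (Nat.lt_succ_self _)]
        all_goals
          obtain h2 | h2 := neg_one_pow_eq_or ℂ k <;>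
            simp [h2, pow_add] <;> ring
    · rcases a with _ | _ <;>
        simp [coord_of_lt (Nat.lt_succ_self _)] <;> ring
  G_D := by
    intro v
    ext b
    change G n (D (n + 1) v) b = (reducedComplex n).twistD (G n v) b
    rcases b with ⟨⟨⟨_ | k, hk⟩, a, b⟩ | a, _ | c⟩
    · rcases a with _ | _ <;> rcases b with _ | _ <;> simp [coord_of_lt hk]
    · rcases a with _ | _ <;> rcases b with _ | _ <;> rcases c with _ | _ <;>
        simp [coord_of_lt (Nat.zero_lt_succ n)]
    · have h := Nat.lt_of_succ_lt hk
      rcases a with _ | _ <;> rcases b with _ | _ <;>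
        simp [coord_of_lt hk, coord_of_lt h]
    · have h := Nat.lt_of_succ_lt hk
      rcases a with _ | _ <;> rcases b with _ | _ <;> rcases c with _ | _ <;>
        simp [coord_of_lt h, coord_of_lt (Nat.lt_succ_of_lt hk), coord_of_lt (Nat.lt_succ_of_lt h)]
      all_goals
        obtain h1 | h1 := neg_one_pow_eq_or ℂ n <;> obtain h2 | h2 := neg_one_pow_eq_or ℂ k <;>
          simp [h1, h2, pow_add] <;> ring
    · rcases a with _ | _ <;>
        simp [coord_of_lt (Nat.lt_succ_self _), ← mul_assoc, mul_add, neg_one_pow_mul_self,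
          add_comm]
    · obtain _ | n := n <;> rcases a with _ | _ <;> rcases c with _ | _ <;>
        simp [coord_of_lt (Nat.lt_succ_self _)]
      all_goals
        obtain h1 | h1 := neg_one_pow_eq_or ℂ n <;> simp [h1, pow_succ] <;> ring
  F_x := by
    intro v
    ext b
    change F n ((reducedComplex n).twistX v) b = x (n + 1) (F n v) b
    rcases b with ⟨⟨k, hk⟩, a, c⟩ | a
    · obtain hk' | rfl := Nat.lt_succ_iff_lt_or_eq.1 hk
      · rw [F_inl_of_lt _ _ _ hk']
        rcases c with _ | _ <;> simp [coord_of_lt hk, F_inl_of_lt _ _ _ hk']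
      · rw [F_inl_last]
        rcases c with _ | _ <;> simp [coord_of_lt hk]
    · rcases a with _ | _ <;> simp
  G_x := by
    intro v
    ext b
    change G n (x (n + 1) v) b = (reducedComplex n).twistX (G n v) b
    rcases b with ⟨⟨⟨k, hk⟩, a, b⟩ | a, _ | c⟩
    · rcases b with _ | _ <;> simp [coord_of_lt hk]
    · rcases b with _ | _ <;> rcases c with _ | _ <;> simp [coord_of_lt (Nat.lt_succ_of_lt hk)]
    · rcases a with _ | _ <;> simp
    · rcases c with _ | _ <;> simp [coord_of_lt (Nat.lt_succ_self _)]
  H_x := by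
    intro v
    ext b
    change H n ((reducedComplex n).twistX v) b = (reducedComplex n).twistX (H n v) b
    rcases b with ⟨⟨⟨k, hk⟩, a, b⟩ | a, _ | c⟩
    · rcases b with _ | _ <;> simp [coord_of_lt hk]
    · rcases b with _ | _ <;> rcases c with _ | _ <;> simp [coord_of_lt hk]
    · rcases a with _ | _ <;> simp
    · rcases c with _ | _ <;> simp
  F_G := by
    intro v
    ext b
    rcases b with ⟨⟨k, hk⟩, a, c⟩ | a
    · obtain hk' | rfl := Nat.lt_succ_iff_lt_or_eq.1 hk
      · rw [F_inl_of_lt _ _ _ hk', prev_G]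
        simp [coord_of_lt hk, ← mul_assoc, neg_one_pow_mul_self]
      · rw [F_inl_last, prev_G]
        simp [coord_of_lt hk, ← mul_assoc, neg_one_pow_mul_self]
    · simp
  G_F := by
    intro v
    ext b
    change _ = v b + (reducedComplex n).twistD (H n v) b +
      H n ((reducedComplex n).twistD v) b
    rcases b with ⟨⟨⟨_ | k, hk⟩, a, b⟩ | a, _ | c⟩
    · rcases a with _ | _ <;> rcases b with _ | _ <;> simp [coord_of_lt hk]
    · rcases a with _ | _ <;> rcases b with _ | _ <;> rcases c with _ | _ <;>
        simp [coord_of_lt (Nat.zero_lt_succ n), coord_of_lt hk, F_inl_zero _ _ _ hk]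
    · have h := Nat.lt_of_succ_lt hk
      rcases a with _ | _ <;> rcases b with _ | _ <;>
        simp [coord_of_lt hk, coord_of_lt h, ← mul_assoc, pow_add, neg_one_pow_mul_self]
    · have h := Nat.lt_of_succ_lt hk
      rcases a with _ | _ <;> rcases b with _ | _ <;> rcases c with _ | _ <;>
        simp [coord_of_lt h, coord_of_lt (Nat.lt_succ_of_lt hk), F_inl_of_lt _ _ _ hk,
          coord_of_lt hk]
      all_goals
        obtain h1 | h1 := neg_one_pow_eq_or ℂ n <;> obtain h2 | h2 := neg_one_pow_eq_or ℂ k <;>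
          simp [h1, h2, pow_add] <;> ring
    · obtain _ | n := n <;> rcases a with _ | _ <;>
        simp [coord_of_lt (Nat.lt_succ_self _)]
    · obtain _ | n := n
      · rcases a with _ | _ <;> simp [coord_of_lt Nat.one_pos]
      · rcases a with _ | _ <;> simp [coord_of_lt (Nat.lt_succ_self _)]
        all_goals obtain h1 | h1 := neg_one_pow_eq_or ℂ n <;> simp [h1, pow_succ, add_comm]

/-- The complex `V` is the reduced complex without crossings. -/
def baseRetract : Retract baseComplex (reducedComplex 0) where
  F := LinearMap.pi fun
    | .inl p => p.1.elim0
    | .inr a => LinearMap.proj a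
  G := LinearMap.pi fun a => LinearMap.proj (.inr a)
  H := 0
  F_homogeneous := by
    rintro v (⟨k, _⟩ | a) hv
    · exact k.elim0
    · exact hv a rfl (by simp [baseComplex, reducedComplex, ReducedIndex.q])
  G_homogeneous := by
    intro v a hv
    exact hv (.inr a) rfl (by simp [baseComplex, reducedComplex, ReducedIndex.q])
  H_homogeneous := fun _ _ _ => rfl
  F_D := by
    intro v
    ext b
    rcases b with ⟨k, _⟩ | _ | _
    · exact k.elim0
    · rfl
    · exact (add_zero _).symm
  G_D := by
    intro v
    ext a
    rcases a with _ | _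
    · rfl
    · exact add_zero _
  F_x := by
    intro v
    ext b
    rcases b with ⟨k, _⟩ | _ | _
    · exact k.elim0
    all_goals rfl
  G_x := by
    intro v
    ext a
    rcases a with _ | _ <;> rfl
  H_x := by simp
  F_G := by
    intro v
    ext b
    rcases b with ⟨k, _⟩ | _
    · exact k.elim0
    · rfl
  G_F := by
    intro v
    simp
    rfl

/-- The iterated cone retracts to the reduced complex. -/
def codeRetract : (n : ℕ) → Retract (codeComplex n) (reducedComplex n)
  | 0 => baseRetract
  | n + 1 => (reducedRetract n).comp (codeRetract n).twist

/-! ### Sequences with a basis that come from a complex on a bigraded set -/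

open Classical in
/-- An identification of the bases of `S` with the parts of a bigraded set `B` such that the
differential of `S` is that of a complex on `B`. -/
structure Realization (S : BasedSequence) {B : Type} (C : XComplex B) where
  toFun : ∀ k, S.basis k → B
  injective : ∀ k, Function.Injective (toFun k)
  w_toFun : ∀ k a, C.w (toFun k a) = k
  q_toFun : ∀ k a, C.q (toFun k a) = S.qdeg k a
  exists_eq : ∀ b, ∃ a, toFun (C.w b) a = b
  D_single : ∀ k a a', C.D (Pi.single (toFun k a) 1) (toFun (k + 1) a') = S.d k a' a

namespace Realization

variable {S T U : BasedSequence} {B B' B'' : Type} {C : XComplex B} {R : XComplex B'}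
  {Q : XComplex B''} (φ : Realization S C) (ψ : Realization T R) (χ : Realization U Q)

/-- Extension by zero from the part of homological degree `k`. -/
noncomputable def incl (k : ℕ) : S.space k →ₗ[ℂ] (B → ℂ) :=
  Function.ExtendByZero.linearMap ℂ (φ.toFun k)

/-- Restriction to the part of homological degree `k`. -/
def proj (k : ℕ) : (B → ℂ) →ₗ[ℂ] S.space k := LinearMap.funLeft ℂ ℂ (φ.toFun k)

theorem proj_apply (k : ℕ) (v : B → ℂ) (a : S.basis k) : φ.proj k v a = v (φ.toFun k a) := rfl

@[simp] theorem incl_toFun (k : ℕ) (v : S.space k) (a : S.basis k) :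
    φ.incl k v (φ.toFun k a) = v a :=
  (φ.injective k).extend_apply _ _ _

theorem incl_of_ne {k : ℕ} {b : B} (h : C.w b ≠ k) (v : S.space k) : φ.incl k v b = 0 :=
  Function.extend_apply' _ _ _ (by
    rintro ⟨a, rfl⟩
    exact h (φ.w_toFun k a))

theorem exists_toFun_eq {k : ℕ} {b : B} (h : C.w b = k) : ∃ a, φ.toFun k a = b := by
  subst h
  exact φ.exists_eq b

@[simp] theorem proj_incl (k : ℕ) (v : S.space k) : φ.proj k (φ.incl k v) = v := by
  ext a
  simp [proj_apply]

theorem incl_proj {k : ℕ} {v : B → ℂ} (hv : ∀ b, C.w b ≠ k → v b = 0) :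
    φ.incl k (φ.proj k v) = v := by
  ext b
  by_cases h : C.w b = k
  · obtain ⟨a, rfl⟩ := φ.exists_toFun_eq h
    simp [proj_apply]
  · rw [φ.incl_of_ne h, hv b h]

open Classical in
theorem incl_single (k : ℕ) (a : S.basis k) :
    φ.incl k (Pi.single a 1) = Pi.single (φ.toFun k a) 1 := by
  ext b
  by_cases h : C.w b = k
  · obtain ⟨a', rfl⟩ := φ.exists_toFun_eq h
    simp [Pi.single_apply, (φ.injective k).eq_iff]
  · rw [φ.incl_of_ne h, Pi.single_eq_of_ne]
    rintro rfl
    exact h (φ.w_toFun k a)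

/-- The component of a linear map from degree `k` to degree `l`. -/
noncomputable def component (f : (B → ℂ) →ₗ[ℂ] (B' → ℂ)) (k l : ℕ) :
    S.space k →ₗ[ℂ] T.space l :=
  ψ.proj l ∘ₗ f ∘ₗ φ.incl k

theorem component_apply (f : (B → ℂ) →ₗ[ℂ] (B' → ℂ)) (k l : ℕ) (v : S.space k) :
    φ.component ψ f k l v = ψ.proj l (f (φ.incl k v)) := rfl

theorem toLin'_d (k : ℕ) : Matrix.toLin' (S.d k) = φ.component φ C.D k (k + 1) := by
  refine LinearMap.pi_ext' fun a => LinearMap.ext_ring ?_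
  ext a'
  have h := φ.D_single k a a'
  rw [← φ.incl_single] at h
  simp only [LinearMap.comp_apply, LinearMap.single_apply, component_apply, proj_apply,
    Matrix.toLin'_apply, Matrix.mulVec_single_one, Matrix.col_apply]
  rw [← h]

variable {φ ψ χ} {f : (B → ℂ) →ₗ[ℂ] (B' → ℂ)} {i : ℤ}

/-- A homogeneous map sends functions supported in degree k to functions supported in degree l, so
restricting to degree l loses nothing. This is what lets identities between total maps pass to
components. -/
theorem incl_component (hf : IsHomogeneous C.w C.q R.w R.q i 0 f) {k l : ℕ} (h : (k : ℤ) + i = l)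
    (v : S.space k) : ψ.incl l (φ.component ψ f k l v) = f (φ.incl k v) :=
  ψ.incl_proj fun b' hb' => hf _ _ fun b hb _ => φ.incl_of_ne (by omega) v

theorem component_eq_zero (hf : IsHomogeneous C.w C.q R.w R.q i 0 f) {k l : ℕ}
    (h : (k : ℤ) + i ≠ l) : φ.component ψ f k l = 0 := by
  ext v a
  refine hf _ _ fun b hb _ => φ.incl_of_ne ?_ _
  rw [ψ.w_toFun] at hb
  omega

theorem preservesDegree_component (hf : IsHomogeneous C.w C.q R.w R.q i 0 f) (k l : ℕ) :
    BasedSequence.PreservesDegree (φ.component ψ f k l) := by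
  intro j v hv a' ha'
  refine hf _ _ fun b _ hq => ?_
  by_cases h : C.w b = k
  · obtain ⟨a, rfl⟩ := φ.exists_toFun_eq h
    rw [incl_toFun]
    refine hv a ?_
    rw [φ.q_toFun, ψ.q_toFun] at hq
    omega
  · exact φ.incl_of_ne h v

theorem component_comp (hf : IsHomogeneous C.w C.q R.w R.q i 0 f)
    (g : (B' → ℂ) →ₗ[ℂ] (B'' → ℂ)) {k l : ℕ} (h : (k : ℤ) + i = l) (m : ℕ) (v : S.space k) :
    ψ.component χ g l m (φ.component ψ f k l v) = χ.proj m (g (f (φ.incl k v))) := by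
  rw [component_apply, incl_component hf h]

theorem isComplex (φ : Realization S C) : S.IsComplex where
  d_mul_d := fun k => by
    apply Matrix.toLin'.injective
    rw [Matrix.toLin'_mul, φ.toLin'_d, φ.toLin'_d, map_zero]
    refine LinearMap.ext fun v => ?_
    rw [LinearMap.comp_apply, component_comp C.D_homogeneous _ (by simp), C.D_D]
    simp
  preserves := fun k => by
    rw [φ.toLin'_d]
    exact preservesDegree_component C.D_homogeneous _ _

theorem toCochainComplex_d (φ : Realization S C) (hS : S.IsComplex) (k : ℕ) :
    (S.toCochainComplex hS).d k (k + 1) = ModuleCat.ofHom (φ.component φ C.D k (k + 1)) := by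
  rw [← φ.toLin'_d]
  exact CochainComplex.of_d (fun k => ModuleCat.of ℂ (S.space k))
    (fun k => ModuleCat.ofHom (Matrix.toLin' (S.d k))) k

/-- The chain map given by the components of a map of degree `0`. -/
noncomputable def chainMap (φ : Realization S C) (ψ : Realization T R)
    (hS : S.IsComplex) (hT : T.IsComplex)
    (hf : IsHomogeneous C.w C.q R.w R.q 0 0 f) (hD : ∀ v, f (C.D v) = R.D (f v)) :
    S.toCochainComplex hS ⟶ T.toCochainComplex hT :=
  CochainComplex.ofHom (fun k => ModuleCat.ofHom (φ.component ψ f k k)) fun k => by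
    rw [φ.toCochainComplex_d, ψ.toCochainComplex_d]
    refine ModuleCat.hom_ext (LinearMap.ext fun (v : S.space k) => ?_)
    change ψ.component ψ R.D k (k + 1) (φ.component ψ f k k v) =
      φ.component ψ f (k + 1) (k + 1) (φ.component φ C.D k (k + 1) v)
    rw [component_comp hf _ (by simp), component_comp C.D_homogeneous _ (by simp), hD]

/-- The components of a map, as morphisms between the terms of the cochain complexes. -/
noncomputable def termMap (φ : Realization S C) (ψ : Realization T R)
    (hS : S.IsComplex) (hT : T.IsComplex) (f : (B → ℂ) →ₗ[ℂ] (B' → ℂ)) (k l : ℕ) :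
    (S.toCochainComplex hS).X k ⟶ (T.toCochainComplex hT).X l :=
  ModuleCat.ofHom (φ.component ψ f k l)

/-- Realizations of homotopy equivalent complexes are homotopy equivalent. -/
theorem gradedHomotopyEquivalent (φ : Realization S C) (ψ : Realization T R)
    (hS : S.IsComplex) (hT : T.IsComplex) (t : Retract C R) :
    S.GradedHomotopyEquivalent T hS hT := by
  refine ⟨{
    hom := φ.chainMap ψ hS hT t.F_homogeneous t.F_D
    inv := ψ.chainMap φ hT hS t.G_homogeneous t.G_D
    homotopyHomInvId :=
      { hom := φ.termMap φ hS hS t.H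
        zero := fun k l h => by
          rw [termMap, component_eq_zero t.H_homogeneous]
          · rfl
          · intro h'
            exact h (show l + 1 = k by omega)
        comm := fun k => ?_ }
    -- F ∘ G is the identity on the nose, so this homotopy is zero.
    homotopyInvHomId := Homotopy.ofEq ?_ }, fun k => ?_, fun k => ?_, fun k l => ?_, fun k l => ?_⟩
  · rw [Homotopy.dNext_cochainComplex, φ.toCochainComplex_d]
    obtain _ | k := k
    · rw [Homotopy.prevD_zero_cochainComplex, add_zero]
      refine ModuleCat.hom_ext (LinearMap.ext fun (v : S.space 0) => ?_)
      change ψ.component φ t.G 0 0 (φ.component ψ t.F 0 0 v) =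
        φ.component φ t.H 1 0 (φ.component φ C.D 0 1 v) + v
      -- In degree 0 the term D H is missing from the homotopy relation; it vanishes since H would
      -- land in degree -1.
      have h : t.H (φ.incl 0 v) = 0 := by
        ext b
        exact t.H_homogeneous _ _ fun b' hb _ => φ.incl_of_ne (by omega) _
      rw [component_comp t.F_homogeneous _ (by simp), component_comp C.D_homogeneous _ (by simp),
        t.G_F, h]
      simp [add_comm]
    · rw [Homotopy.prevD_succ_cochainComplex, φ.toCochainComplex_d]
      refine ModuleCat.hom_ext (LinearMap.ext fun (v : S.space (k + 1)) => ?_)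
      change ψ.component φ t.G (k + 1) (k + 1) (φ.component ψ t.F (k + 1) (k + 1) v) =
        φ.component φ t.H (k + 1 + 1) (k + 1) (φ.component φ C.D (k + 1) (k + 1 + 1) v) +
          φ.component φ C.D k (k + 1) (φ.component φ t.H (k + 1) k v) + v
      rw [component_comp t.F_homogeneous _ (by simp), component_comp C.D_homogeneous _ (by simp),
        component_comp t.H_homogeneous _ (by simp), t.G_F]
      simp only [map_add, proj_incl]
      abel
  · ext k : 1
    refine ModuleCat.hom_ext (LinearMap.ext fun (v : T.space k) => ?_)
    change φ.component ψ t.F k k (ψ.component φ t.G k k v) = v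
    rw [component_comp t.G_homogeneous _ (by simp), t.F_G, proj_incl]
  · exact preservesDegree_component t.F_homogeneous k k
  · exact preservesDegree_component t.G_homogeneous k k
  · exact preservesDegree_component t.H_homogeneous k l
  · intro j v _ a _
    rfl

end Realization

/-! ### The differential of the iterated cone in terms of levels -/

/-- The lowest level that is connected to a given level, if `r k` says whether the levels `k` and
`k + 1` are connected. -/
def bottom (r : ℕ → Bool) : ℕ → ℕ
  | 0 => 0
  | k + 1 => if r k = true then bottom r k else k + 1

theorem bottom_le (r : ℕ → Bool) (k : ℕ) : bottom r k ≤ k := by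
  induction k with
  | zero => rfl
  | succ k ih =>
    rw [bottom]
    split_ifs <;> omega

theorem bottom_congr {r r' : ℕ → Bool} {k : ℕ} (h : ∀ j < k, r j = r' j) :
    bottom r k = bottom r' k := by
  induction k with
  | zero => rfl
  | succ k ih => rw [bottom, bottom, h k (by omega), ih fun j hj => h j (by omega)]

theorem bottom_succ_of_true {r : ℕ → Bool} {k : ℕ} (h : r k = true) :
    bottom r (k + 1) = bottom r k := by simp [bottom, h]

theorem bottom_succ_of_false {r : ℕ → Bool} {k : ℕ} (h : r k = false) :
    bottom r (k + 1) = k + 1 := by simp [bottom, h]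

/-- A function which is constant on connected levels takes the same value at a level and at the
lowest level connected to it. -/
theorem apply_bottom {α : Type*} {r : ℕ → Bool} {t : ℕ → α} {n : ℕ}
    (h : ∀ k < n, r k = true → t (k + 1) = t k) {k : ℕ} (hk : k ≤ n) : t (bottom r k) = t k := by
  induction k with
  | zero => rfl
  | succ k ih =>
    rw [bottom]
    split_ifs with hr
    · rw [ih (by omega), h k (by omega) hr]
    · rfl

namespace Code

/-- Whether a crossing is `1`-smoothed. -/
def res : {n : ℕ} → Code n → ℕ → Bool
  | 0, _, _ => false
  | n + 1, (c, o), j => if j = n then o.isNone else res (n := n) c j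

/-- The label of a level. -/
def lab : {n : ℕ} → Code n → ℕ → KhLabel
  | 0, l, _ => l
  | n + 1, (c, o), j => if j ≤ n then lab (n := n) c j else o.getD (lab (n := n) c n)

/-- The code with given smoothings and labels. -/
def ofFun (r : ℕ → Bool) (t : ℕ → KhLabel) : (n : ℕ) → Code n
  | 0 => t 0
  | n + 1 => (ofFun r t n, if r n = true then none else some (t (n + 1)))

variable {n : ℕ} (c c' : Code n) (o o' : Option KhLabel)

@[simp] theorem res_last : res (n := n + 1) (c, o) n = o.isNone := by simp [res]

theorem res_of_lt {j : ℕ} (h : j < n) : res (n := n + 1) (c, o) j = res c j := by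
  simp [res, h.ne]

theorem lab_of_le {j : ℕ} (h : j ≤ n) : lab (n := n + 1) (c, o) j = lab c j := by
  simp [lab, h]

@[simp] theorem lab_last : lab (n := n + 1) (c, o) (n + 1) = o.getD (lab c n) := by
  simp [lab]

theorem bottom_res {j : ℕ} (h : j ≤ n) :
    bottom (res (n := n + 1) (c, o)) j = bottom (res c) j :=
  bottom_congr fun _ hi => res_of_lt c o (by omega)

/-- A 1-smoothed crossing stores `none`, and `lab` then falls back to the level below. -/
theorem lab_succ {k : ℕ} (hk : k < n) (h : res c k = true) : lab c (k + 1) = lab c k := by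
  induction n with
  | zero => omega
  | succ n ih =>
    obtain ⟨c, o⟩ := c
    obtain hk' | rfl := Nat.lt_succ_iff_lt_or_eq.1 hk
    · rw [res_of_lt c o hk'] at h
      rw [lab_of_le c o (by omega), lab_of_le c o (by omega), ih c hk' h]
    · rw [res_last, Option.isNone_iff_eq_none] at h
      simp [h, lab_of_le c none le_rfl]

variable {c c'}

theorem lab_bottom {k : ℕ} (hk : k ≤ n) : lab c (bottom (res c) k) = lab c k :=
  apply_bottom (fun _ hk h => lab_succ c hk h) hk

/-- The top entry of a code is recovered from two readings: the last smoothing says whether it is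
`none`, and otherwise the label of the top level is the stored one. -/
theorem eq_iff : c = c' ↔ (∀ j < n, res c' j = res c j) ∧ ∀ j ≤ n, lab c' j = lab c j := by
  constructor
  · rintro rfl
    exact ⟨fun _ _ => rfl, fun _ _ => rfl⟩
  · induction n with
    | zero => exact fun h => (h.2 0 le_rfl).symm
    | succ n ih =>
      obtain ⟨c, o⟩ := c
      obtain ⟨c', o'⟩ := c'
      rintro ⟨hr, ht⟩
      obtain rfl : c = c' := ih
        ⟨fun j hj => by simpa [res_of_lt _ _ hj] using hr j (by omega),
          fun j hj => by simpa [lab_of_le _ _ hj] using ht j (by omega)⟩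
      have h1 := hr n (by omega)
      have h2 := ht (n + 1) le_rfl
      rw [res_last, res_last] at h1
      rw [lab_last, lab_last] at h2
      obtain rfl : o = o' := by cases o <;> cases o' <;> simp_all
      rfl

theorem res_ofFun (r : ℕ → Bool) (t : ℕ → KhLabel) {j : ℕ} (hj : j < n) :
    res (ofFun r t n) j = r j := by
  induction n with
  | zero => omega
  | succ n ih =>
    obtain hj' | rfl := Nat.lt_succ_iff_lt_or_eq.1 hj
    · rw [ofFun, res_of_lt _ _ hj', ih hj']
    · rw [ofFun, res_last]
      cases r j <;> simp

/-- `ofFun` forgets `t` at every level glued to the one below; constancy of `t` along glued levels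
restores it. -/
theorem lab_ofFun (r : ℕ → Bool) (t : ℕ → KhLabel) (h : ∀ k < n, r k = true → t (k + 1) = t k)
    {j : ℕ} (hj : j ≤ n) : lab (ofFun r t n) j = t j := by
  induction n generalizing j with
  | zero =>
    obtain rfl : j = 0 := by omega
    rfl
  | succ n ih =>
    have ih' {j : ℕ} (hj : j ≤ n) := ih (fun k hk => h k (by omega)) hj
    obtain hj' | rfl := Nat.le_succ_iff.1 hj
    · rw [ofFun, lab_of_le _ _ hj', ih' hj']
    · rw [ofFun, Nat.succ_eq_add_one, lab_last]
      split_ifs with hr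
      · simp [ih', h n (by omega) hr]
      · simp

theorem w_eq (c : Code n) :
    (codeComplex n).w c = ((Finset.range n).filter fun j => res c j = true).card := by
  induction n with
  | zero => rfl
  | succ n ih =>
    obtain ⟨c, o⟩ := c
    have h : (Finset.range n).filter (fun j => res (n := n + 1) (c, o) j = true) =
        (Finset.range n).filter fun j => res c j = true :=
      Finset.filter_congr fun j hj => by rw [res_of_lt _ _ (Finset.mem_range.1 hj)]
    rw [Finset.range_add_one, Finset.filter_insert, h, res_last]
    cases o
    · simp only [Option.isNone_none, if_true]
      rw [Finset.card_insert_of_notMem (by simp), ← ih]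
      rfl
    · simp only [Option.isNone_some, Bool.false_eq_true, if_false]
      exact ih c

/-- Each loop is counted once, at its lowest level, that is, at a level j with `bottom` equal to j.
A new entry `some l` opens a loop with label l, while `none` opens none and raises the shift by 1.
-/
theorem q_eq (c : Code n) :
    (codeComplex n).q c = (codeComplex n).w c +
      ∑ j ∈ (Finset.range (n + 1)).filter fun j => bottom (res c) j = j, (lab c j).deg := by
  induction n with
  | zero =>
    simp [codeComplex, baseComplex, bottom, Finset.filter_singleton]
    rfl
  | succ n ih =>
    obtain ⟨c, o⟩ := c
    have h : (Finset.range (n + 1)).filter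
        (fun j => bottom (res (n := n + 1) (c, o)) j = j) =
        (Finset.range (n + 1)).filter fun j => bottom (res c) j = j :=
      Finset.filter_congr fun j hj => by
        rw [bottom_res _ _ (Nat.lt_succ_iff.1 (Finset.mem_range.1 hj))]
    have h' : ∑ j ∈ (Finset.range (n + 1)).filter fun j => bottom (res c) j = j,
        (lab (n := n + 1) (c, o) j).deg =
        ∑ j ∈ (Finset.range (n + 1)).filter fun j => bottom (res c) j = j, (lab c j).deg :=
      Finset.sum_congr rfl fun j hj => by
        rw [lab_of_le _ _ (Nat.lt_succ_iff.1 (Finset.mem_range.1 (Finset.mem_filter.1 hj).1))]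
    have hb := bottom_le (res c) n
    rw [Finset.range_add_one, Finset.filter_insert, h]
    cases o with
    | none =>
      rw [bottom_succ_of_true (by simp), bottom_res _ _ le_rfl, if_neg (by omega), h']
      change (codeComplex n).q c + 1 = (((codeComplex n).w c + 1 : ℕ) : ℤ) + _
      rw [ih]
      push_cast
      ring
    | some l =>
      rw [bottom_succ_of_false (by simp), if_pos rfl, Finset.sum_insert (by simp), h', lab_last]
      change (codeComplex n).q c + l.deg = ((codeComplex n).w c : ℤ) + (l.deg + _)
      rw [ih]
      ring

/-! ### Matrix entries of the iterated cone, crossing by crossing. -/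

/-- The matrix entry from `c` to `c'` of the part of the differential that belongs to the
crossing `k`. -/
noncomputable def coeff (c c' : Code n) (k : ℕ) : ℂ :=
  open Classical in
  if res c k = false ∧ (∀ j < n, res c' j = if j = k then true else res c j) ∧
      ∀ j ≤ n, bottom (res c) j ≠ bottom (res c) k → bottom (res c) j ≠ bottom (res c) (k + 1) →
        lab c' j = lab c j then
    (-1) ^ ((Finset.range k).filter fun l => res c' l = true).card *
      KhLabel.mulCoeff (lab c k) (lab c (k + 1)) (lab c' k)
  else 0

-- The top entry is a spectator for a lower crossing: its smoothing must not change, and if it opens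
-- a loop of its own, that loop avoids the crossing and keeps its label. If the top level is glued
-- to level n, its condition repeats the one for level n.
open Classical in
theorem coeff_of_lt (c c' : Code n) (o o' : Option KhLabel) {k : ℕ} (hk : k < n) :
    coeff (n := n + 1) (c, o) (c', o') k = if o = o' then coeff c c' k else 0 := by
  have hs : (Finset.range k).filter (fun l => res (n := n + 1) (c', o') l = true) =
      (Finset.range k).filter fun l => res c' l = true :=
    Finset.filter_congr fun l hl => by
      rw [res_of_lt _ _ ((Finset.mem_range.1 hl).trans hk)]
  unfold coeff
  rw [hs, res_of_lt c o hk, lab_of_le c o hk.le, lab_of_le c o hk, lab_of_le c' o' hk.le,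
    bottom_res c o hk.le, bottom_res c o hk]
  have hb := bottom_le (res c) k
  have hb' := bottom_le (res c) (k + 1)
  by_cases ho : o = o'
  · subst ho
    rw [if_pos rfl]
    refine if_congr (and_congr Iff.rfl (and_congr ?_ ?_)) rfl rfl
    · constructor
      · intro h j hj
        simpa only [res_of_lt _ _ hj] using h j (by omega)
      · intro h j hj
        obtain hj' | rfl := Nat.lt_succ_iff_lt_or_eq.1 hj
        · simpa only [res_of_lt _ _ hj'] using h j hj'
        · simp [hk.ne']
    · constructor
      · intro h j hj
        simpa only [lab_of_le _ _ hj, bottom_res _ _ hj] using h j (by omega)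
      · intro h j hj
        obtain hj' | rfl := Nat.le_succ_iff.1 hj
        · simpa only [lab_of_le _ _ hj', bottom_res _ _ hj'] using h j hj'
        · rw [Nat.succ_eq_add_one, lab_last, lab_last]
          cases o with
          | none =>
            rw [bottom_succ_of_true (by simp), bottom_res _ _ le_rfl]
            exact h n le_rfl
          | some l => exact fun _ _ => rfl
  · rw [if_neg ho, if_neg]
    rintro ⟨-, h1, h2⟩
    have h1 := h1 n n.lt_succ_self
    have h2 := h2 (n + 1) le_rfl
    rw [if_neg hk.ne', res_last, res_last] at h1
    rw [lab_last, lab_last] at h2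
    cases o with
    | none => cases o' <;> simp_all
    | some l =>
      rw [bottom_succ_of_false (by simp)] at h2
      have h2 := h2 (by omega) (by have := bottom_le (res c) k.succ; omega)
      cases o' <;> simp_all

/-- All levels glued to level n carry the same label, so agreement at n settles the whole loop. -/
theorem eq_of_forall_bottom_ne (hr : ∀ j < n, res c' j = res c j)
    (hl : ∀ j ≤ n, bottom (res c) j ≠ bottom (res c) n → lab c' j = lab c j)
    (h : lab c' n = lab c n) : c = c' := by
  refine eq_iff.2 ⟨hr, fun j hj => ?_⟩
  by_cases hb : bottom (res c) j = bottom (res c) n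
  · have hb' : bottom (res c') j = bottom (res c') n := by
      rwa [bottom_congr fun i hi => hr i (hi.trans_le hj), bottom_congr hr]
    rw [← lab_bottom hj, hb', lab_bottom le_rfl, h, ← lab_bottom le_rfl, ← hb, lab_bottom hj]
  · exact hl j hj hb

-- The last crossing merges the newest loop into the loop of level n. With label 𝟏 this changes
-- nothing below; with label X it multiplies the lower loop by X, in the form found again in
-- `x_single`. The exponent of the sign is the full weight of `c'`, as every other crossing is
-- earlier.
open Classical in
theorem coeff_last (c c' : Code n) (o o' : Option KhLabel) :
    coeff (n := n + 1) (c, o) (c', o') n =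
      match o, o' with
      | some .one, none => if c = c' then (-1) ^ (codeComplex n).w c' else 0
      | some .X, none => if (∀ j < n, res c' j = res c j) ∧
          (∀ j ≤ n, bottom (res c) j ≠ bottom (res c) n → lab c' j = lab c j) ∧
          lab c n = .one ∧ lab c' n = .X then (-1) ^ (codeComplex n).w c' else 0
      | _, _ => 0 := by
  have hs : (Finset.range n).filter (fun l => res (n := n + 1) (c', o') l = true) =
      (Finset.range n).filter fun l => res c' l = true :=
    Finset.filter_congr fun l hl => by rw [res_of_lt _ _ (Finset.mem_range.1 hl)]
  unfold coeff
  rw [hs, ← w_eq, res_last, lab_last, lab_of_le c o le_rfl, lab_of_le c' o' le_rfl,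
    bottom_res c o le_rfl]
  have hb := bottom_le (res c) n
  match o, o' with
  | none, _ => simp
  | some l, some l' =>
    rw [if_neg]
    · cases l <;> rfl
    · rintro ⟨-, h, -⟩
      simpa using h n n.lt_succ_self
  | some l, none =>
    have hP : (((some l).isNone = false ∧
        (∀ j < n + 1, res (n := n + 1) (c', none) j =
          if j = n then true else res (n := n + 1) (c, some l) j) ∧
        ∀ j ≤ n + 1, bottom (res (n := n + 1) (c, some l)) j ≠ bottom (res c) n →
          bottom (res (n := n + 1) (c, some l)) j ≠
            bottom (res (n := n + 1) (c, some l)) (n + 1) →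
          lab (n := n + 1) (c', none) j = lab (n := n + 1) (c, some l) j)) ↔
        (∀ j < n, res c' j = res c j) ∧
          ∀ j ≤ n, bottom (res c) j ≠ bottom (res c) n → lab c' j = lab c j := by
      refine (and_iff_right rfl).trans (and_congr ?_ ?_)
      · constructor
        · intro h j hj
          simpa only [res_of_lt _ _ hj, if_neg hj.ne] using h j (by omega)
        · intro h j hj
          obtain hj' | rfl := Nat.lt_succ_iff_lt_or_eq.1 hj
          · simpa only [res_of_lt _ _ hj', if_neg hj'.ne] using h j hj'
          · simp
      · rw [bottom_succ_of_false (k := n) (by simp)]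
        constructor
        · intro h j hj hj'
          have := bottom_le (res c) j
          have h := h j (by omega)
          rw [bottom_res _ _ hj, lab_of_le _ _ hj, lab_of_le _ _ hj] at h
          exact h hj' (by omega)
        · intro h j hj h1 h2
          obtain hj' | rfl := Nat.le_succ_iff.1 hj
          · rw [bottom_res _ _ hj'] at h1
            rw [lab_of_le _ _ hj', lab_of_le _ _ hj', h j hj' h1]
          · exact absurd (bottom_succ_of_false (by simp)) h2
    rw [if_congr hP rfl rfl]
    cases l with
    | one =>
      by_cases hc : c = c'
      · subst hc
        cases h : lab c n <;> simp [KhLabel.mulCoeff]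
      · simp only [hc, if_false, Option.getD_some]
        split_ifs with hQ
        · have := mt (eq_of_forall_bottom_ne hQ.1 hQ.2) hc
          cases h : lab c n <;> cases h' : lab c' n <;> simp_all [KhLabel.mulCoeff]
        · rfl
    | X =>
      cases h : lab c n <;> cases h' : lab c' n <;> simp [KhLabel.mulCoeff]

section succ

variable (v : Code (n + 1) → ℂ) (c' : Code n)

theorem D_succ_some (l : KhLabel) : (codeComplex (n + 1)).D v (c', some l) =
    (codeComplex n).D (part (B := Code n) (some l) v) c' := rfl

theorem D_succ_none : (codeComplex (n + 1)).D v (c', none) =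
    (codeComplex n).D (part (B := Code n) none v) c' + (-1) ^ (codeComplex n).w c' *
        (part (B := Code n) (some .one) v c' +
          (codeComplex n).x (part (B := Code n) (some .X) v) c') := rfl

theorem x_succ_one : (codeComplex (n + 1)).x v (c', some .one) = 0 := rfl

theorem x_succ_X : (codeComplex (n + 1)).x v (c', some .X) =
    part (B := Code n) (some .one) v c' := rfl

theorem x_succ_none : (codeComplex (n + 1)).x v (c', none) =
    (codeComplex n).x (part (B := Code n) none v) c' := rfl

open Classical in
theorem part_single (c : Code n) (o o' : Option KhLabel) :
    part (B := Code n) o' (Pi.single (M := fun _ : Code (n + 1) => ℂ) (c, o) (1 : ℂ)) =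
      if o = o' then Pi.single c 1 else 0 := by
  ext b
  by_cases hb : b = c ∧ o = o'
  · obtain ⟨rfl, rfl⟩ := hb
    rw [if_pos rfl, Pi.single_eq_same]
    exact Pi.single_eq_same (M := fun _ : Code (n + 1) => ℂ) _ _
  · trans (0 : ℂ)
    · refine Pi.single_eq_of_ne (M := fun _ : Code (n + 1) => ℂ) ?_ _
      rintro h
      obtain ⟨h1, h2⟩ := Prod.mk.inj h
      exact hb ⟨h1, h2.symm⟩
    · split_ifs with ho
      · rw [Pi.single_eq_of_ne fun h => hb ⟨h, ho⟩]
      · rfl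

end succ

theorem baseComplex_x_single (inst : DecidableEq KhLabel) (a b : KhLabel) :
    baseComplex.x (@Pi.single KhLabel (fun _ => ℂ) _ inst a 1) b =
      if a = .one ∧ b = .X then 1 else 0 := by
  cases b
  · simp only [reduceCtorEq, and_false, if_false]
    rfl
  · simp only [and_true, eq_comm (a := a)]
    refine (Pi.single_apply (M := ℂ) _ _ _).trans ?_
    congr

-- X acts on the loop through the top level. If the last entry is `some`, that loop consists of the
-- top level alone; if it is `none`, it is the loop of level n, and the induction hypothesis
-- applies.
open Classical in
theorem x_single (c c' : Code n) :
    (codeComplex n).x (Pi.single c 1) c' = if (∀ j < n, res c' j = res c j) ∧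
          (∀ j ≤ n, bottom (res c) j ≠ bottom (res c) n → lab c' j = lab c j) ∧
          lab c n = .one ∧ lab c' n = .X then 1 else 0 := by
  induction n with
  | zero =>
    refine (baseComplex_x_single _ c c').trans ?_
    by_cases h : lab c 0 = .one ∧ lab c' 0 = .X
    · exact (if_pos h).trans (by simp [h])
    · exact (if_neg h).trans (by simp [h])
  | succ n ih =>
    obtain ⟨c, o⟩ := c
    obtain ⟨c', o'⟩ := c'
    rw [lab_last, lab_last]
    match o, o' with
    | o, some .one => simp [x_succ_one]
    | none, some .X =>
      rw [x_succ_X, part_single, if_neg (by simp), if_neg]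
      · rfl
      · rintro ⟨h, -⟩
        simpa using h n n.lt_succ_self
    | some .X, some .X =>
      rw [x_succ_X, part_single]
      simp
    | some .one, some .X =>
      rw [x_succ_X, part_single, if_pos rfl, Pi.single_apply]
      refine if_congr ?_ rfl rfl
      rw [eq_comm, eq_iff]
      constructor
      · rintro ⟨h1, h2⟩
        refine ⟨fun j hj => ?_, fun j hj hb => ?_, rfl, rfl⟩
        · obtain hj' | rfl := Nat.lt_succ_iff_lt_or_eq.1 hj
          · rw [res_of_lt _ _ hj', res_of_lt _ _ hj', h1 j hj']
          · simp
        · obtain hj' | rfl := Nat.le_succ_iff.1 hj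
          · rw [lab_of_le _ _ hj', lab_of_le _ _ hj', h2 j hj']
          · exact absurd rfl hb
      · rintro ⟨h1, h2, -⟩
        refine ⟨fun j hj => ?_, fun j hj => ?_⟩
        · simpa only [res_of_lt _ _ hj] using h1 j (by omega)
        · have := bottom_le (res c) j
          have h2 := h2 j (by omega)
          rw [bottom_succ_of_false (k := n) (by simp), bottom_res _ _ hj, lab_of_le _ _ hj,
            lab_of_le _ _ hj] at h2
          exact h2 (by omega)
    | some l, none =>
      rw [x_succ_none, part_single, if_neg (by simp), if_neg, map_zero]
      · rfl
      · rintro ⟨h, -⟩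
        simpa using h n n.lt_succ_self
    | none, none =>
      rw [x_succ_none, part_single, if_pos rfl, ih]
      refine if_congr (and_congr ?_ (and_congr ?_ Iff.rfl)) rfl rfl
      · constructor
        · intro h j hj
          obtain hj' | rfl := Nat.lt_succ_iff_lt_or_eq.1 hj
          · rw [res_of_lt _ _ hj', res_of_lt _ _ hj', h j hj']
          · simp
        · intro h j hj
          simpa only [res_of_lt _ _ hj] using h j (by omega)
      · rw [bottom_succ_of_true (k := n) (by simp), bottom_res _ _ le_rfl]
        constructor
        · intro h j hj
          obtain hj' | rfl := Nat.le_succ_iff.1 hj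
          · simpa only [lab_of_le _ _ hj', bottom_res _ _ hj'] using h j hj'
          · intro hb
            rw [Nat.succ_eq_add_one, bottom_succ_of_true (by simp), bottom_res _ _ le_rfl] at hb
            exact absurd rfl hb
        · intro h j hj
          simpa only [lab_of_le _ _ hj, bottom_res _ _ hj] using h j (by omega)

-- The recursion of the cone is the splitting of the sum over crossings: the crossings below the
-- last one act on each part separately, and the last one is the parity term of `twistD`.
open Classical in
theorem D_single (c c' : Code n) :
    (codeComplex n).D (Pi.single c 1) c' = ∑ k ∈ Finset.range n, coeff c c' k := by
  induction n with
  | zero => rfl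
  | succ n ih =>
    obtain ⟨c, o⟩ := c
    obtain ⟨c', o'⟩ := c'
    rw [Finset.sum_range_succ, Finset.sum_congr rfl fun k hk =>
      coeff_of_lt c c' o o' (Finset.mem_range.1 hk), coeff_last]
    cases o' with
    | some l =>
      rw [D_succ_some, part_single]
      rcases o with _ | _ | _ <;> split_ifs <;> simp [ih]
    | none =>
      rw [D_succ_none, part_single, part_single, part_single]
      rcases o with _ | _ | _
      · simp [ih]
      · simp [Pi.single_apply, eq_comm]
      · simp [x_single]

end Code

/-! ### The Khovanov bracket of the twisted unknot -/

namespace TwistedUnknot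

/-- The smoothings of a resolution, as a function on `ℕ`. -/
def extend {n : ℕ} (r : Fin n → Bool) (j : ℕ) : Bool := if h : j < n then r ⟨j, h⟩ else false

theorem extend_of_lt {n : ℕ} (r : Fin n → Bool) {j : ℕ} (h : j < n) : extend r j = r ⟨j, h⟩ := by
  simp [extend, h]

@[simp] theorem extend_coe {n : ℕ} (r : Fin n → Bool) (k : Fin n) : extend r k = r k :=
  extend_of_lt r k.2

variable {n : ℕ}

/-- The level of an edge: the edges `k` and `-k` have level `k`. -/
def level (e : ZMod (2 * n)) : ℕ := e.valMinAbs.natAbs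

@[simp] theorem level_neg (e : ZMod (2 * n)) : level (-e) = level e :=
  ZMod.natAbs_valMinAbs_neg e

theorem level_natCast {k : ℕ} (h : k ≤ n) : level (k : ZMod (2 * n)) = k := by
  rw [level, ZMod.valMinAbs_natCast_of_le_half (by omega), Int.natAbs_natCast]

theorem twistedUnknot_of_even {k : Fin n} (h : Even (k : ℕ)) : twistedUnknot n k =
    ![((k : ℕ) : ZMod (2 * n)), -((k : ℕ) : ZMod (2 * n)), ((k : ℕ) : ZMod (2 * n)) + 1,
      -(((k : ℕ) : ZMod (2 * n)) + 1)] := by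
  simp [twistedUnknot, h]

theorem twistedUnknot_of_not_even {k : Fin n} (h : ¬Even (k : ℕ)) : twistedUnknot n k =
    ![-(((k : ℕ) : ZMod (2 * n)) + 1), ((k : ℕ) : ZMod (2 * n)) + 1, -((k : ℕ) : ZMod (2 * n)),
      ((k : ℕ) : ZMod (2 * n))] := by
  simp [twistedUnknot, h]

theorem level_le [NeZero n] (e : ZMod (2 * n)) : level e ≤ n := by
  have := ZMod.natAbs_valMinAbs_le e
  rw [level]
  omega

theorem eq_or_eq_neg_level [NeZero n] (e : ZMod (2 * n)) :
    e = level e ∨ e = -(level e : ZMod (2 * n)) := by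
  rw [level, ZMod.natCast_natAbs_valMinAbs]
  split_ifs <;> simp

@[simp] theorem level_coe (k : Fin n) : level ((k : ℕ) : ZMod (2 * n)) = k :=
  level_natCast k.2.le

@[simp] theorem level_coe_add_one (k : Fin n) : level (((k : ℕ) : ZMod (2 * n)) + 1) = k + 1 := by
  rw [← Nat.cast_add_one, level_natCast k.2]

@[simp] theorem level_neg_add_one (k : Fin n) :
    level (-1 + -((k : ℕ) : ZMod (2 * n))) = k + 1 := by
  rw [← neg_add_rev, level_neg, level_coe_add_one]

/-- The edges `a`, `c` of a crossing are on the two levels around it. -/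
theorem level_crossing (k : Fin n) :
    (level (twistedUnknot n k 0) = k ∧ level (twistedUnknot n k 2) = k + 1) ∨
      (level (twistedUnknot n k 0) = k + 1 ∧ level (twistedUnknot n k 2) = k) := by
  by_cases h : Even (k : ℕ)
  · simp [twistedUnknot_of_even h]
  · simp [twistedUnknot_of_not_even h]

/-- A 0-smoothing joins edges of equal level. A 1-smoothing joins an edge of level k to one of level
k + 1, and then `bottom` takes the same value at both. -/
theorem bottom_eq_of_joined {r : Fin n → Bool} {e e' : ZMod (2 * n)}
    (h : (twistedUnknot n).Joined r e e') :
    bottom (extend r) (level e) = bottom (extend r) (level e') := by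
  obtain ⟨k, hk⟩ := h
  have hb (hr : r k = true) : bottom (extend r) (k + 1) = bottom (extend r) k :=
    bottom_succ_of_true (by simpa using hr)
  by_cases h : Even (k : ℕ)
  · simp only [twistedUnknot_of_even h] at hk
    rcases hk with ⟨_, ⟨rfl, rfl⟩ | ⟨rfl, rfl⟩⟩ | ⟨hr, ⟨rfl, rfl⟩ | ⟨rfl, rfl⟩⟩ <;>
      simp [*]
  · simp only [twistedUnknot_of_not_even h] at hk
    rcases hk with ⟨_, ⟨rfl, rfl⟩ | ⟨rfl, rfl⟩⟩ | ⟨hr, ⟨rfl, rfl⟩ | ⟨rfl, rfl⟩⟩ <;>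
      simp [*]

/-- The lowest level of a loop. -/
def loopBottom (r : Fin n → Bool) : (twistedUnknot n).Loop r → ℕ :=
  Quot.lift (fun e => bottom (extend r) (level e)) fun _ _ h => bottom_eq_of_joined h

theorem loopOf_of_false {r : Fin n → Bool} {k : Fin n} (h : r k = false) :
    (twistedUnknot n).loopOf r (-(((k : ℕ) : ZMod (2 * n)) + 1)) =
      (twistedUnknot n).loopOf r (((k : ℕ) : ZMod (2 * n)) + 1) := by
  by_cases hk : Even (k : ℕ)
  · exact (Quot.sound ⟨k, Or.inl ⟨h, Or.inr (by simp [twistedUnknot_of_even hk])⟩⟩).symm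
  · exact Quot.sound ⟨k, Or.inl ⟨h, Or.inl (by simp [twistedUnknot_of_not_even hk])⟩⟩

theorem loopOf_of_true {r : Fin n → Bool} {k : Fin n} (h : r k = true) :
    (twistedUnknot n).loopOf r (-(((k : ℕ) : ZMod (2 * n)) + 1)) =
      (twistedUnknot n).loopOf r (k : ℕ) ∧
    (twistedUnknot n).loopOf r (((k : ℕ) : ZMod (2 * n)) + 1) =
      (twistedUnknot n).loopOf r (-((k : ℕ) : ZMod (2 * n))) := by
  by_cases hk : Even (k : ℕ)
  · exact ⟨(Quot.sound ⟨k, Or.inr ⟨h, Or.inl (by simp [twistedUnknot_of_even hk])⟩⟩).symm,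
      Quot.sound ⟨k, Or.inr ⟨h, Or.inr (by simp [twistedUnknot_of_even hk])⟩⟩⟩
  · exact ⟨Quot.sound ⟨k, Or.inr ⟨h, Or.inl (by simp [twistedUnknot_of_not_even hk])⟩⟩,
      (Quot.sound ⟨k, Or.inr ⟨h, Or.inr (by simp [twistedUnknot_of_not_even hk])⟩⟩).symm⟩

/-- Induction up the stack from level 0, whose two edges 0 and -0 coincide. A 0-smoothing joins k +
1 with -(k + 1); a 1-smoothing joins k + 1 with -k and -(k + 1) with k, so both signs have to be
carried along. -/
theorem loopOf_bottom (r : Fin n → Bool) {k : ℕ} (hk : k ≤ n) :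
    (twistedUnknot n).loopOf r k = (twistedUnknot n).loopOf r (bottom (extend r) k : ℕ) ∧
    (twistedUnknot n).loopOf r (-(k : ZMod (2 * n))) =
      (twistedUnknot n).loopOf r (bottom (extend r) k : ℕ) := by
  induction k with
  | zero => simp [bottom]
  | succ k ih =>
    have ih := ih (by omega)
    cases hr : r ⟨k, hk⟩ with
    | false =>
      rw [bottom_succ_of_false (by rw [extend_of_lt r hk, hr])]
      push_cast
      exact ⟨rfl, loopOf_of_false hr⟩
    | true =>
      rw [bottom_succ_of_true (by rw [extend_of_lt r hk, hr])]
      push_cast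
      exact ⟨(loopOf_of_true hr).2.trans ih.2, (loopOf_of_true hr).1.trans ih.1⟩

/-! ### Enhanced states as codes. -/

variable {i : ℕ}

/-- The code of an enhanced state. -/
def code (S : (twistedUnknot n).EnhancedState i) : Code n :=
  Code.ofFun (extend S.r) (fun j => S.label (j : ZMod (2 * n))) n

theorem res_code (S : (twistedUnknot n).EnhancedState i) {j : ℕ} (hj : j < n) :
    (code S).res j = S.r ⟨j, hj⟩ := by
  rw [code, Code.res_ofFun _ _ hj, extend_of_lt]

theorem bottom_code (S : (twistedUnknot n).EnhancedState i) {j : ℕ} (hj : j ≤ n) :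
    bottom (code S).res j = bottom (extend S.r) j :=
  bottom_congr fun k hk => by rw [res_code S (by omega), extend_of_lt]

theorem card_filter_res (S : (twistedUnknot n).EnhancedState i) {k : ℕ} (hk : k ≤ n) :
    ((Finset.range k).filter fun j => (code S).res j = true).card =
      (Finset.univ.filter fun l : Fin n => (l : ℕ) < k ∧ S.r l = true).card := by
  symm
  refine Finset.card_bij (fun l _ => (l : ℕ)) ?_ (fun _ _ _ _ h => Fin.ext h) ?_
  · intro l hl
    simpa [res_code S l.2] using hl
  · intro j hj
    simp only [Finset.mem_filter, Finset.mem_range] at hj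
    have hjn := hj.1.trans_le hk
    exact ⟨⟨j, hjn⟩, by simpa [hj.1, res_code S hjn] using hj.2, rfl⟩

theorem w_code (S : (twistedUnknot n).EnhancedState i) : (codeComplex n).w (code S) = i := by
  rw [Code.w_eq, card_filter_res S le_rfl]
  refine Eq.trans ?_ S.weight_eq
  simp [PDCode.weight]

variable [NeZero n]

theorem loopOf_eq (r : Fin n → Bool) (e : ZMod (2 * n)) :
    (twistedUnknot n).loopOf r e =
      (twistedUnknot n).loopOf r (bottom (extend r) (level e) : ℕ) := by
  have h := loopOf_bottom r (level_le e)
  obtain he | he := eq_or_eq_neg_level e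
  · rw [← h.1, ← he]
  · rw [← h.2, ← he]

/-- `loopBottom` is well defined on loops, and conversely each edge lies on the loop of its bottom
level: the lowest level is a complete invariant of a loop. -/
theorem loopOf_eq_iff (r : Fin n → Bool) (e e' : ZMod (2 * n)) :
    (twistedUnknot n).loopOf r e = (twistedUnknot n).loopOf r e' ↔
      bottom (extend r) (level e) = bottom (extend r) (level e') :=
  ⟨fun h => congrArg (loopBottom r) h, fun h => by rw [loopOf_eq, loopOf_eq r e', h]⟩

theorem loopBottom_injective (r : Fin n → Bool) : Function.Injective (loopBottom r) := by
  rintro ⟨e⟩ ⟨e'⟩ h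
  exact (loopOf_eq_iff r e e').2 h

theorem range_loopBottom (r : Fin n → Bool) : Set.range (loopBottom r) =
    ((Finset.range (n + 1)).filter fun j => bottom (extend r) j = j : Finset ℕ) := by
  ext j
  simp only [Set.mem_range, Finset.coe_filter, Finset.mem_range, Set.mem_ofPred_eq]
  constructor
  · rintro ⟨⟨e⟩, rfl⟩
    have h1 := bottom_le (extend r) (level e)
    have h2 := level_le e
    exact ⟨Nat.lt_succ_of_le (h1.trans h2), apply_bottom (t := bottom (extend r))
      (fun k _ hk => bottom_succ_of_true hk) h2⟩
  · rintro ⟨h1, h2⟩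
    refine ⟨(twistedUnknot n).loopOf r (j : ℕ), ?_⟩
    change bottom (extend r) (level (j : ZMod (2 * n))) = j
    rw [level_natCast (by omega), h2]

theorem label_eq (S : (twistedUnknot n).EnhancedState i) (e : ZMod (2 * n)) :
    S.label e = S.label (level e : ℕ) := by
  rw [PDCode.EnhancedState.label, PDCode.EnhancedState.label]
  congr 1
  rw [loopOf_eq_iff, level_natCast (level_le e)]

theorem label_succ (S : (twistedUnknot n).EnhancedState i) (k : ℕ) (hk : k < n)
    (h : extend S.r k = true) : S.label ((k + 1 : ℕ) : ZMod (2 * n)) = S.label (k : ℕ) := by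
  rw [PDCode.EnhancedState.label, PDCode.EnhancedState.label]
  congr 1
  rw [loopOf_eq_iff, level_natCast hk, level_natCast hk.le, bottom_succ_of_true h]

theorem lab_code (S : (twistedUnknot n).EnhancedState i) {j : ℕ} (hj : j ≤ n) :
    (code S).lab j = S.label (j : ZMod (2 * n)) :=
  Code.lab_ofFun _ _ (label_succ S) hj

theorem lab_code_level (S : (twistedUnknot n).EnhancedState i) (e : ZMod (2 * n)) :
    (code S).lab (level e) = S.label e := by
  rw [lab_code S (level_le e), ← label_eq]

theorem q_code (S : (twistedUnknot n).EnhancedState i) : (codeComplex n).q (code S) = S.qdeg := by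
  have h (l : (twistedUnknot n).Loop S.r) :
      (S.s l).deg = (S.label ((loopBottom S.r l : ℕ) : ZMod (2 * n))).deg := by
    obtain ⟨e⟩ := l
    have := congrArg (fun l => (S.s l).deg) (loopOf_eq S.r e)
    exact this
  -- The sum over loops is transported along the injection `loopBottom` to a sum over lowest levels.
  rw [Code.q_eq, w_code, PDCode.EnhancedState.qdeg, finsum_congr h,
    ← finsum_mem_range (f := fun j : ℕ => (S.label (j : ZMod (2 * n))).deg)
      (loopBottom_injective S.r), range_loopBottom, finsum_mem_coe_finset]
  congr 1
  have h' : (Finset.range (n + 1)).filter (fun j => bottom (code S).res j = j) =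
      (Finset.range (n + 1)).filter fun j => bottom (extend S.r) j = j :=
    Finset.filter_congr fun j hj => by
      rw [bottom_code S (Nat.lt_succ_iff.1 (Finset.mem_range.1 hj))]
  rw [h']
  refine Finset.sum_congr rfl fun j hj => ?_
  rw [lab_code S (Nat.lt_succ_iff.1 (Finset.mem_range.1 (Finset.mem_filter.1 hj).1))]

theorem code_injective : Function.Injective (code (n := n) (i := i)) := by
  intro S T h
  have hr : S.r = T.r := by
    ext k
    rw [← res_code S k.2, h, res_code T k.2]
  have hl (e : ZMod (2 * n)) : S.label e = T.label e := by
    rw [← lab_code_level, h, lab_code_level]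
  obtain ⟨r, s, hS⟩ := S
  obtain ⟨r', s', hT⟩ := T
  obtain rfl : r = r' := hr
  obtain rfl : s = s' := by
    ext ⟨e⟩
    exact hl e
  rfl

theorem exists_code_eq (c : Code n) :
    ∃ S : (twistedUnknot n).EnhancedState ((codeComplex n).w c), code S = c := by
  let r : Fin n → Bool := fun k => c.res k
  have hr {j : ℕ} (hj : j < n) : extend r j = c.res j := extend_of_lt r hj
  have hb {j : ℕ} (hj : j ≤ n) : bottom (extend r) j = bottom c.res j :=
    bottom_congr fun k hk => hr (by omega)
  let S : (twistedUnknot n).EnhancedState ((codeComplex n).w c) :=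
    { r := r
      -- Joined edges have the same bottom level, and `lab` is constant from a level down to its
      -- bottom.
      s := Quot.lift (fun e => c.lab (level e)) fun e e' h => by
        have h := bottom_eq_of_joined h
        rw [hb (level_le _), hb (level_le _)] at h
        rw [← Code.lab_bottom (level_le e), h, Code.lab_bottom (level_le e')]
      weight_eq := by
        rw [PDCode.weight, Code.w_eq]
        refine Finset.card_bij (fun l _ => (l : ℕ)) ?_ (fun _ _ _ _ h => Fin.ext h) ?_
        · intro l hl
          simpa using hl
        · intro j hj
          simp only [Finset.mem_filter, Finset.mem_range] at hj
          exact ⟨⟨j, hj.1⟩, by simpa using hj.2, rfl⟩ }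
  refine ⟨S, Code.eq_iff.2 ⟨fun j hj => ?_, fun j hj => ?_⟩⟩
  · exact (res_code S hj).symm
  · rw [lab_code S hj]
    exact congrArg c.lab (level_natCast hj).symm

theorem mulCoeff_comm (a b c : KhLabel) : KhLabel.mulCoeff a b c = KhLabel.mulCoeff b a c := by
  cases a <;> cases b <;> cases c <;> rfl

theorem ite_eq_ite {α : Type*} {p q : Prop} {_ : Decidable p} {_ : Decidable q} {a b c : α}
    (hpq : p ↔ q) (h : q → a = b) : (if p then a else c) = if q then b else c := by
  by_cases hq : q
  · rw [if_pos hq, if_pos (hpq.2 hq), h hq]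
  · rw [if_neg hq, if_neg (mt hpq.1 hq)]

/-- The edges a and c of a crossing lie on adjacent levels, which are different loops while the
crossing is 0-smoothed, so the split branch is never taken. For odd k the roles of a and c are
exchanged, which is harmless because the merge is commutative and the merged loop has one label. -/
theorem edgeCoeff_eq {j : ℕ} (S : (twistedUnknot n).EnhancedState i)
    (T : (twistedUnknot n).EnhancedState j) (k : Fin n) :
    (twistedUnknot n).edgeCoeff S T k = Code.coeff (code S) (code T) k := by
  unfold PDCode.edgeCoeff Code.coeff
  refine ite_eq_ite ?_ fun h => ?_
  · rw [res_code S k.2]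
    refine and_congr_right fun hS => and_congr ?_ ?_
    · constructor
      · rintro h l hl
        rw [res_code T hl, res_code S hl, h, Function.update_apply]
        simp [Fin.ext_iff]
      · intro h
        ext l
        rw [← res_code T l.2, h l l.2, Function.update_apply, res_code S l.2]
        simp [Fin.ext_iff]
    · have h0 : (∀ e, (twistedUnknot n).loopOf S.r e ≠
            (twistedUnknot n).loopOf S.r (twistedUnknot n k 0) →
          (twistedUnknot n).loopOf S.r e ≠
            (twistedUnknot n).loopOf S.r (twistedUnknot n k 2) → T.label e = S.label e) ↔
          ∀ e : ZMod (2 * n), bottom (code S).res (level e) ≠ bottom (code S).res k →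
            bottom (code S).res (level e) ≠ bottom (code S).res (k + 1) →
              (code T).lab (level e) = (code S).lab (level e) := by
        refine forall_congr' fun e => ?_
        rw [Ne, Ne, loopOf_eq_iff, loopOf_eq_iff, lab_code_level, lab_code_level,
          bottom_code S (level_le e), bottom_code S k.2.le, bottom_code S k.2]
        obtain ⟨h1, h2⟩ | ⟨h1, h2⟩ := level_crossing k
        · rw [h1, h2]
        · rw [h1, h2]
          exact ⟨fun h a b => h b a, fun h a b => h b a⟩
      refine h0.trans ⟨fun h l hl => ?_, fun h e => h _ (level_le e)⟩
      simpa only [level_natCast hl] using h (l : ℕ)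
  · have hS := h.1
    rw [res_code S k.2] at hS
    have hT : (code T).res k = true := by simpa using h.2.1 k k.2
    have hne : bottom (extend S.r) k ≠ bottom (extend S.r) (k + 1) := by
      rw [bottom_succ_of_false (k := (k : ℕ)) (by simpa using hS)]
      have := bottom_le (extend S.r) k
      omega
    have hsign : (Finset.univ.filter fun l : Fin n => l < k ∧ T.r l = true).card =
        ((Finset.range k).filter fun l => (code T).res l = true).card :=
      (card_filter_res T k.2.le).symm
    have hT' := Code.lab_succ (code T) k.2 hT
    rw [hsign, if_neg, ← lab_code_level, ← lab_code_level, ← lab_code_level]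
    · congr 1
      obtain ⟨h1, h2⟩ | ⟨h1, h2⟩ := level_crossing k
      · rw [h1, h2]
      · rw [h1, h2, hT', mulCoeff_comm]
    · rw [loopOf_eq_iff]
      obtain ⟨h1, h2⟩ | ⟨h1, h2⟩ := level_crossing k
      · rwa [h1, h2]
      · rw [h1, h2]
        exact hne.symm

open Classical in
/-- The Khovanov bracket of the twisted unknot is the iterated cone. -/
noncomputable def realization (n : ℕ) [NeZero n] :
    Realization (twistedUnknot n).khovanovBracket (codeComplex n) where
  toFun := fun _ => code
  injective := fun _ => code_injective
  w_toFun := fun _ => w_code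
  q_toFun := fun _ => q_code
  exists_eq := exists_code_eq
  D_single := fun _ S T => by
    rw [Code.D_single, Finset.sum_range]
    exact Finset.sum_congr rfl fun k _ => (edgeCoeff_eq S T k).symm

end TwistedUnknot

namespace ReducedTwist

/-! ### The reduced complex is a complex -/

/-- The basis vectors of the reduced complex. -/
def toIndex (n k : ℕ) (i : Fin (dim n k)) : ReducedIndex n :=
  if h : k < n then .inl (⟨k, h⟩, pairBasis (Fin.cast (dim_of_lt h) i))
  else if h : k = n then .inr (singleBasis (Fin.cast (dim_of_eq h) i))
  -- A dummy value: above degree n the basis is empty.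
  else .inr .one

theorem toIndex_of_lt {n k : ℕ} (h : k < n) (i : Fin 4) :
    toIndex n k (Fin.cast (dim_of_lt h).symm i) = .inl (⟨k, h⟩, pairBasis i) := by
  simp [toIndex, h]

theorem toIndex_self {n : ℕ} (i : Fin 2) :
    toIndex n n (Fin.cast (dim_of_eq rfl).symm i) = .inr (singleBasis i) := by
  simp [toIndex]

/-- The basis in degree `k`. -/
theorem dim_cases {n k : ℕ} (i : Fin (dim n k)) :
    (∃ (h : k < n) (j : Fin 4), i = Fin.cast (dim_of_lt h).symm j) ∨
      (∃ (h : k = n) (j : Fin 2), i = Fin.cast (dim_of_eq h).symm j) := by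
  by_cases h : k < n
  · exact Or.inl ⟨h, Fin.cast (dim_of_lt h) i, rfl⟩
  · by_cases h' : k = n
    · exact Or.inr ⟨h', Fin.cast (dim_of_eq h') i, rfl⟩
    · have := i.2
      simp [dim, h, h'] at this

theorem pairBasis_injective : Function.Injective pairBasis := by decide

theorem singleBasis_injective : Function.Injective singleBasis := by decide

theorem d_of_lt {n k : ℕ} (h : k + 1 < n) : (complex n).d k =
    (if Even (n - k) then dMinus else dPlus).submatrix
      (Fin.cast (dim_of_lt h)) (Fin.cast (dim_of_lt (Nat.lt_of_succ_lt h))) := by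
  simp only [complex, dif_pos h]

theorem d_last (n : ℕ) : (complex (n + 1)).d n =
    dLast.submatrix (Fin.cast (dim_of_eq rfl)) (Fin.cast (dim_of_lt n.lt_succ_self)) := by
  simp [complex]

theorem d_of_le {n k : ℕ} (h : n ≤ k) : (complex n).d k = 0 := by
  have h1 : ¬ k + 1 < n := by omega
  have h2 : ¬ k + 1 = n := by omega
  simp only [complex, dif_neg h1, dif_neg h2]
  rfl

open Classical in
/-- The reduced complex is realized by `reducedComplex`. -/
noncomputable def realization (n : ℕ) : Realization (complex n) (reducedComplex n) where
  toFun := toIndex n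
  injective := by
    intro k i i' h
    obtain ⟨hk, j, rfl⟩ | ⟨rfl, j, rfl⟩ := dim_cases i <;>
      obtain ⟨hk', j', rfl⟩ | ⟨hk', j', rfl⟩ := dim_cases i'
    · rw [toIndex_of_lt hk, toIndex_of_lt hk] at h
      rw [pairBasis_injective (Prod.mk.inj (Sum.inl_injective h)).2]
    · omega
    · omega
    · rw [toIndex_self, toIndex_self] at h
      rw [singleBasis_injective (Sum.inr_injective h)]
  w_toFun := by
    intro k i
    obtain ⟨hk, j, rfl⟩ | ⟨rfl, j, rfl⟩ := dim_cases i
    · rw [toIndex_of_lt hk]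
      rfl
    · rw [toIndex_self]
      rfl
  q_toFun := by
    intro k i
    obtain ⟨hk, j, rfl⟩ | ⟨rfl, j, rfl⟩ := dim_cases i
    · rw [toIndex_of_lt hk]
      simp [reducedComplex, ReducedIndex.q, complex, hk]
    · rw [toIndex_self]
      simp [reducedComplex, ReducedIndex.q, complex]
  exists_eq := by
    rintro (⟨k, p⟩ | a)
    · obtain ⟨j, rfl⟩ : ∃ j, pairBasis j = p := by
        revert p
        decide
      exact ⟨_, toIndex_of_lt k.2 j⟩
    · obtain ⟨j, rfl⟩ : ∃ j, singleBasis j = a := by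
        revert a
        decide
      exact ⟨_, toIndex_self j⟩
  D_single := by
    intro k i i'
    obtain ⟨hk, j, rfl⟩ | ⟨rfl, j, rfl⟩ := dim_cases i <;>
      obtain ⟨hk', j', rfl⟩ | ⟨hk', j', rfl⟩ := dim_cases i'
    · rw [toIndex_of_lt hk, toIndex_of_lt hk', d_of_lt hk']
      obtain ⟨m, rfl⟩ : ∃ m, n = k + m := ⟨n - k, by omega⟩
      rw [Nat.add_sub_cancel_left]
      -- With target degree k + 1 and n = k + m, the sign ε is -1 exactly when n - k is even, which
      -- is when the matrix is `dMinus`.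
      have hs : (-1 : ℂ) ^ (k + m + (k + 1)) = if Even m then -1 else 1 := by
        have : (-1 : ℂ) ^ (k + m + (k + 1)) = -((-1) ^ k * (-1) ^ k * (-1) ^ m) := by ring
        rw [this, neg_one_pow_mul_self]
        split_ifs with hm
        · simp [hm]
        · simp [Nat.not_even_iff_odd.1 hm]
      by_cases hm : Even m
      · rw [if_pos hm] at hs ⊢
        fin_cases j <;> fin_cases j' <;>
          simp [pairBasis, dMinus, ReducedIndex.coord_of_lt hk, hs]
      · rw [if_neg hm] at hs ⊢
        fin_cases j <;> fin_cases j' <;>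
          simp [pairBasis, dPlus, ReducedIndex.coord_of_lt hk, hs]
    · subst hk'
      rw [toIndex_of_lt hk, toIndex_self, d_last]
      fin_cases j <;> fin_cases j' <;>
        simp [pairBasis, singleBasis, dLast, ReducedIndex.coord_of_lt hk]
    · omega
    · omega

end ReducedTwist

namespace ReducedTwist

/-! ### The Laplacians -/

open Matrix

theorem submatrix_cast_conjTranspose_mul_self {a b a' b' : ℕ} (ha : a' = a) (hb : b' = b)
    (A : Matrix (Fin a) (Fin b) ℂ) :
    ((A.submatrix (Fin.cast ha) (Fin.cast hb))ᴴ * A.submatrix (Fin.cast ha) (Fin.cast hb)).submatrix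
      (Fin.cast hb.symm) (Fin.cast hb.symm) = Aᴴ * A := by
  subst ha hb
  rfl

theorem submatrix_cast_mul_conjTranspose_self {a b a' b' : ℕ} (ha : a' = a) (hb : b' = b)
    (A : Matrix (Fin a) (Fin b) ℂ) :
    (A.submatrix (Fin.cast ha) (Fin.cast hb) * (A.submatrix (Fin.cast ha) (Fin.cast hb))ᴴ).submatrix
      (Fin.cast ha.symm) (Fin.cast ha.symm) = A * Aᴴ := by
  subst ha hb
  rfl

/-- The differential in degree `n - m`. -/
noncomputable def dAlt (m : ℕ) : Matrix (Fin 4) (Fin 4) ℂ := if Even m then dMinus else dPlus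

theorem pairLaplacian_zero {n : ℕ} (h : 1 < n) (h₀ : 0 < n) :
    pairLaplacian n 0 h₀ = (dAlt n)ᴴ * dAlt n := by
  rw [pairLaplacian, BasedSequence.laplacian, d_of_lt h]
  exact submatrix_cast_conjTranspose_mul_self _ _ _

theorem pairLaplacian_succ {n k : ℕ} (h : k + 2 < n) (hk : k + 1 < n) :
    pairLaplacian n (k + 1) hk =
      (dAlt (n - (k + 1)))ᴴ * dAlt (n - (k + 1)) + dAlt (n - k) * (dAlt (n - k))ᴴ := by
  rw [pairLaplacian, BasedSequence.laplacian, d_of_lt h, d_of_lt (Nat.lt_of_succ_lt h),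
    Matrix.submatrix_add]
  exact congrArg₂ (· + ·) (submatrix_cast_conjTranspose_mul_self _ _ _)
    (submatrix_cast_mul_conjTranspose_self _ _ _)

theorem pairLaplacian_last {k : ℕ} (h : k + 1 < k + 2) :
    pairLaplacian (k + 2) (k + 1) h = dLastᴴ * dLast + dMinus * dMinusᴴ := by
  rw [pairLaplacian, BasedSequence.laplacian, d_last, d_of_lt (by omega), if_pos (by simp),
    Matrix.submatrix_add]
  exact congrArg₂ (· + ·) (submatrix_cast_conjTranspose_mul_self _ _ _)
    (submatrix_cast_mul_conjTranspose_self _ _ _)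

theorem pairLaplacian_one : pairLaplacian 1 0 zero_lt_one = dLastᴴ * dLast := by
  rw [pairLaplacian, BasedSequence.laplacian, d_last]
  exact submatrix_cast_conjTranspose_mul_self _ _ _

theorem lastLaplacian_succ (n : ℕ) : lastLaplacian (n + 1) = dLast * dLastᴴ := by
  rw [lastLaplacian, BasedSequence.laplacian, d_last, d_of_le le_rfl, Matrix.mul_zero, zero_add]
  exact submatrix_cast_mul_conjTranspose_self _ _ _

/-- Write the matrices as 1 ⊗ X ± X ⊗ 1. The mixed terms X ⊗ X† and X† ⊗ X enter the two products
with opposite signs, and X X† + X† X = 1 contributes 1 for each of the two factors. -/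
theorem dPlus_add_dMinus : dPlusᴴ * dPlus + dMinus * dMinusᴴ = diagonal ![2, 2, 2, 2] := by
  ext i j
  simp only [Matrix.add_apply, Matrix.mul_apply, Matrix.conjTranspose_apply, Matrix.diagonal_apply,
    Fin.sum_univ_four]
  fin_cases i <;> fin_cases j <;>
    simp [dPlus, dMinus] <;> norm_num

theorem dMinus_add_dPlus : dMinusᴴ * dMinus + dPlus * dPlusᴴ = diagonal ![2, 2, 2, 2] := by
  ext i j
  simp only [Matrix.add_apply, Matrix.mul_apply, Matrix.conjTranspose_apply, Matrix.diagonal_apply,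
    Fin.sum_univ_four]
  fin_cases i <;> fin_cases j <;>
    simp [dPlus, dMinus] <;> norm_num

/-- The adjoint of the merge and `dMinus` have orthogonal images, spanned by X𝟏 + 𝟏X, 𝟏𝟏 and by XX,
X𝟏 - 𝟏X. The eigenvalue 1 belongs to 𝟏𝟏, which the merge maps to a unit vector. -/
theorem dLast_add_dMinus : dLastᴴ * dLast + dMinus * dMinusᴴ = diagonal ![2, 2, 2, 1] := by
  ext i j
  simp only [Matrix.add_apply, Matrix.mul_apply, Matrix.conjTranspose_apply, Matrix.diagonal_apply,
    Fin.sum_univ_four, Fin.sum_univ_two]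
  fin_cases i <;> fin_cases j <;>
    simp [dLast, dMinus] <;> norm_num

theorem dLast_mul : dLast * dLastᴴ = diagonal ![2, 1] := by
  ext i j
  simp only [Matrix.mul_apply, Matrix.conjTranspose_apply, Matrix.diagonal_apply, Fin.sum_univ_four]
  fin_cases i <;> fin_cases j <;>
    simp [dLast] <;> norm_num

/-- An orthonormal basis of `V ⊗ V` that contains `(X𝟏 + ε 𝟏X) / √2` and `(X𝟏 - ε 𝟏X) / √2`, for a
sign `ε`. -/
noncomputable def rotation (ε : ℂ) : Matrix (Fin 4) (Fin 4) ℂ :=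
  !![0, 0, 1, 0;
     ((√2 / 2 : ℝ) : ℂ), 0, 0, ((√2 / 2 : ℝ) : ℂ);
     ε * ((√2 / 2 : ℝ) : ℂ), 0, 0, -ε * ((√2 / 2 : ℝ) : ℂ);
     0, 1, 0, 0]

theorem half_sqrt_two_mul_self : ((√2 / 2 : ℝ) : ℂ) * ((√2 / 2 : ℝ) : ℂ) = 1 / 2 := by
  rw [← Complex.ofReal_mul, div_mul_div_comm, Real.mul_self_sqrt zero_le_two]
  norm_num

theorem rotation_mem {ε : ℂ} (h : ε = 1 ∨ ε = -1) :
    rotation ε ∈ Matrix.unitaryGroup (Fin 4) ℂ := by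
  have hs := half_sqrt_two_mul_self
  rw [Matrix.mem_unitaryGroup_iff, Matrix.star_eq_conjTranspose]
  generalize hc : ((√2 / 2 : ℝ) : ℂ) = c at hs
  have hc' : (starRingEnd ℂ) c = c := by rw [← hc, Complex.conj_ofReal]
  ext i j
  simp only [Matrix.mul_apply, Matrix.conjTranspose_apply, Matrix.one_apply, Fin.sum_univ_four]
  obtain rfl | rfl := h <;> fin_cases i <;> fin_cases j <;>
    simp [rotation, hc, hc', hs] <;> norm_num

/-- The vectors (X𝟏 - 𝟏X)/√2 and 𝟏𝟏 have orthogonal images of length √2, and XX and X𝟏 + 𝟏X span the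
kernel. -/
theorem dMinus_conj : dMinusᴴ * dMinus =
    rotation (-1) * diagonal ![2, 2, 0, 0] * (rotation (-1))ᴴ := by
  have hs := half_sqrt_two_mul_self
  generalize hc : ((√2 / 2 : ℝ) : ℂ) = c at hs
  have hc' : (starRingEnd ℂ) c = c := by rw [← hc, Complex.conj_ofReal]
  ext i j
  simp only [Matrix.mul_apply, Matrix.conjTranspose_apply, Fin.sum_univ_four]
  fin_cases i <;> fin_cases j <;>
    simp [rotation, dMinus, hc, hc', mul_right_comm, hs] <;> norm_num

theorem dPlus_conj : dPlusᴴ * dPlus =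
    rotation 1 * diagonal ![2, 2, 0, 0] * (rotation 1)ᴴ := by
  have hs := half_sqrt_two_mul_self
  generalize hc : ((√2 / 2 : ℝ) : ℂ) = c at hs
  have hc' : (starRingEnd ℂ) c = c := by rw [← hc, Complex.conj_ofReal]
  ext i j
  simp only [Matrix.mul_apply, Matrix.conjTranspose_apply, Fin.sum_univ_four]
  fin_cases i <;> fin_cases j <;>
    simp [rotation, dPlus, hc, hc', mul_right_comm, hs] <;> norm_num

/-- Needed only for n = 1, where the merge is the whole complex and degree 0 has no incoming map. -/
theorem dLast_conj : dLastᴴ * dLast =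
    rotation 1 * diagonal ![2, 1, 0, 0] * (rotation 1)ᴴ := by
  have hs := half_sqrt_two_mul_self
  generalize hc : ((√2 / 2 : ℝ) : ℂ) = c at hs
  have hc' : (starRingEnd ℂ) c = c := by rw [← hc, Complex.conj_ofReal]
  ext i j
  simp only [Matrix.mul_apply, Matrix.conjTranspose_apply, Fin.sum_univ_four, Fin.sum_univ_two]
  fin_cases i <;> fin_cases j <;>
    simp [rotation, dLast, hc, hc', mul_right_comm, hs]

theorem exists_unitary_pairLaplacian_zero {n : ℕ} (h : 1 < n) (h₀ : 0 < n) :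
    ∃ U ∈ Matrix.unitaryGroup (Fin 4) ℂ,
      pairLaplacian n 0 h₀ = U * diagonal ![2, 2, 0, 0] * Uᴴ := by
  rw [pairLaplacian_zero h h₀, dAlt]
  split_ifs
  · exact ⟨_, rotation_mem (Or.inr rfl), dMinus_conj⟩
  · exact ⟨_, rotation_mem (Or.inl rfl), dPlus_conj⟩

theorem pairLaplacian_congr {n k l : ℕ} (h : k = l) (hk : k < n) (hl : l < n) :
    pairLaplacian n k hk = pairLaplacian n l hl := by
  subst h
  rfl

theorem pairLaplacian_eq {n j : ℕ} (h₁ : 1 < j) (h₂ : j < n) (h₃ : n - j < n) :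
    pairLaplacian n (n - j) h₃ = diagonal ![2, 2, 2, 2] := by
  obtain ⟨k, rfl⟩ : ∃ k, n = k + 1 + j := ⟨n - j - 1, by omega⟩
  have h0 : k + 1 + j - j = k + 1 := by omega
  have h1 : k + 1 + j - (k + 1) = j := by omega
  have h2 : k + 1 + j - k = j + 1 := by omega
  rw [pairLaplacian_congr h0 _ (by omega), pairLaplacian_succ (by omega) _, h1, h2, dAlt, dAlt]
  by_cases h : Even j
  · rw [if_pos h, if_neg (by simpa [Nat.even_add_one] using h), dMinus_add_dPlus]
  · rw [if_neg h, if_pos (by simpa [Nat.even_add_one] using h), dPlus_add_dMinus]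

theorem pairLaplacian_pred {n : ℕ} (h : 1 < n) (h₁ : n - 1 < n) :
    pairLaplacian n (n - 1) h₁ = diagonal ![2, 2, 2, 1] := by
  obtain ⟨k, rfl⟩ : ∃ k, n = k + 2 := ⟨n - 2, by omega⟩
  exact (pairLaplacian_last h₁).trans dLast_add_dMinus

theorem lastLaplacian_eq (n : ℕ) [NeZero n] : lastLaplacian n = diagonal ![2, 1] := by
  obtain ⟨k, rfl⟩ := Nat.exists_eq_succ_of_ne_zero (NeZero.ne n)
  exact (lastLaplacian_succ k).trans dLast_mul

/-! ### The spectral gaps -/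

theorem hasEigenvalue_submatrix_cast {a b : ℕ} (h : b = a) (A : Matrix (Fin a) (Fin a) ℂ) (μ : ℂ) :
    Module.End.HasEigenvalue (Matrix.toLin' (A.submatrix (Fin.cast h) (Fin.cast h))) μ ↔
      Module.End.HasEigenvalue (Matrix.toLin' A) μ := by
  subst h
  rfl

theorem hasEigenvalue_conj_diagonal {m : ℕ} {U : Matrix (Fin m) (Fin m) ℂ}
    (hU : U ∈ Matrix.unitaryGroup (Fin m) ℂ) (v : Fin m → ℂ) (μ : ℂ) :
    Module.End.HasEigenvalue (Matrix.toLin' (U * diagonal v * Uᴴ)) μ ↔ ∃ i, v i = μ := by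
  rw [Module.End.hasEigenvalue_iff_mem_spectrum, Matrix.spectrum_toLin']
  have h := spectrum.units_conjugate (R := ℂ) (a := diagonal v)
    (u := Unitary.toUnits ⟨U, hU⟩)
  -- In the unitary group the inverse is by definition the conjugate transpose.
  have h' : spectrum ℂ (U * diagonal v * Uᴴ) = spectrum ℂ (diagonal v) := h
  rw [h', spectrum_diagonal]
  rfl

theorem isSpectralGap {n k m : ℕ} (h : m = dim n k) {U : Matrix (Fin m) (Fin m) ℂ}
    (hU : U ∈ Matrix.unitaryGroup (Fin m) ℂ) (v : Fin m → ℂ)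
    (hv : ((complex n).laplacian k).submatrix (Fin.cast h) (Fin.cast h) = U * diagonal v * Uᴴ)
    {δ : ℝ} (hδ : δ ≠ 0) (hmem : ∃ i, v i = δ) (hle : ∀ i (μ : ℝ), μ ≠ 0 → v i = μ → δ ≤ μ) :
    (complex n).IsSpectralGap k δ := by
  have hE (μ : ℂ) : Module.End.HasEigenvalue (Matrix.toLin' ((complex n).laplacian k)) μ ↔
      ∃ i, v i = μ := by
    rw [← hasEigenvalue_conj_diagonal hU, ← hv]
    exact (hasEigenvalue_submatrix_cast h _ μ).symm
  refine ⟨⟨hδ, (hE δ).2 hmem⟩, ?_⟩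
  rintro μ ⟨h0, hμ⟩
  obtain ⟨i, hi⟩ := (hE μ).1 hμ
  exact hle i μ h0 hi

theorem isSpectralGap_of_diagonal {n k m : ℕ} (h : m = dim n k) (v : Fin m → ℂ)
    (hv : ((complex n).laplacian k).submatrix (Fin.cast h) (Fin.cast h) = diagonal v)
    {δ : ℝ} (hδ : δ ≠ 0) (hmem : ∃ i, v i = δ) (hle : ∀ i (μ : ℝ), μ ≠ 0 → v i = μ → δ ≤ μ) :
    (complex n).IsSpectralGap k δ :=
  isSpectralGap h (one_mem _) v (by simpa using hv) hδ hmem hle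

theorem le_of_ofReal_eq {δ μ r : ℝ} (h : (r : ℂ) = μ) (hr : δ ≤ r) : δ ≤ μ := by
  rwa [← Complex.ofReal_inj.1 h]

theorem exists_isSpectralGap (n : ℕ) [NeZero n] {k : ℕ} (hk : k ≤ n) :
    ∃ δ : ℝ, (complex n).IsSpectralGap k δ ∧ 1 ≤ δ := by
  have hn := NeZero.pos n
  obtain rfl | hk := hk.eq_or_lt
  · refine ⟨1, isSpectralGap_of_diagonal _ _ (lastLaplacian_eq k) one_ne_zero ⟨1, by simp⟩ ?_,
      le_rfl⟩
    intro i μ _ hi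
    fin_cases i
    · exact le_of_ofReal_eq (r := 2) (by simpa using hi) (by norm_num)
    · exact le_of_ofReal_eq (r := 1) (by simpa using hi) (by norm_num)
  -- For n = 1, degree 0 is also degree n - 1, and its gap is 1. For larger n the gap is 1 in the
  -- degrees n - 1 and n and 2 in all others.
  obtain rfl | hn := (show 1 ≤ n from hn).eq_or_lt
  · obtain rfl : k = 0 := by omega
    refine ⟨1, isSpectralGap _ (rotation_mem (Or.inl rfl)) _
      (pairLaplacian_one.trans dLast_conj) one_ne_zero ⟨1, by simp⟩ ?_, le_rfl⟩
    intro i μ h0 hi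
    fin_cases i
    · exact le_of_ofReal_eq (r := 2) (by simpa using hi) (by norm_num)
    · exact le_of_ofReal_eq (r := 1) (by simpa using hi) (by norm_num)
    all_goals exact absurd (by simpa [eq_comm] using hi) h0
  obtain rfl | hk0 := k.eq_zero_or_pos
  · obtain ⟨U, hU, h⟩ := exists_unitary_pairLaplacian_zero hn (by omega)
    refine ⟨2, isSpectralGap _ hU _ h two_ne_zero ⟨0, by simp⟩ ?_, one_le_two⟩
    intro i μ h0 hi
    fin_cases i
    · exact le_of_ofReal_eq (r := 2) (by simpa using hi) (by norm_num)
    · exact le_of_ofReal_eq (r := 2) (by simpa using hi) (by norm_num)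
    all_goals exact absurd (by simpa [eq_comm] using hi) h0
  obtain ⟨j, rfl⟩ : ∃ j, k = n - j := ⟨n - k, by omega⟩
  obtain hj | rfl := lt_or_eq_of_le (show 1 ≤ j by omega)
  · refine ⟨2, isSpectralGap_of_diagonal _ _ (pairLaplacian_eq hj (by omega) (by omega)) two_ne_zero
      ⟨0, by simp⟩ ?_, one_le_two⟩
    intro i μ h0 hi
    fin_cases i <;> exact le_of_ofReal_eq (r := 2) (by simpa using hi) (by norm_num)
  · refine ⟨1, isSpectralGap_of_diagonal _ _ (pairLaplacian_pred hn (by omega)) one_ne_zero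
      ⟨3, by simp⟩ ?_, le_rfl⟩
    intro i μ h0 hi
    fin_cases i
    iterate 3 exact le_of_ofReal_eq (r := 2) (by simpa using hi) (by norm_num)
    exact le_of_ofReal_eq (r := 1) (by simpa using hi) (by norm_num)

end ReducedTwist

theorem mainTheorem9 (n : ℕ) [NeZero n] :
    (∃ (hK : (twistedUnknot n).khovanovBracket.IsComplex)
       (hR : (ReducedTwist.complex n).IsComplex),
      BasedSequence.GradedHomotopyEquivalent (twistedUnknot n).khovanovBracket
        (ReducedTwist.complex n) hK hR) ∧
    (∀ h : 1 < n, ∃ U ∈ Matrix.unitaryGroup (Fin 4) ℂ,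
      ReducedTwist.pairLaplacian n 0 (by omega) =
        U * Matrix.diagonal ![2, 2, 0, 0] * U.conjTranspose) ∧
    (∀ (j : ℕ) (h₁ : 1 < j) (h₂ : j < n),
      ReducedTwist.pairLaplacian n (n - j) (by omega) = Matrix.diagonal ![2, 2, 2, 2]) ∧
    (∀ h : 1 < n,
      ReducedTwist.pairLaplacian n (n - 1) (by omega) = Matrix.diagonal ![2, 2, 2, 1]) ∧
    ReducedTwist.lastLaplacian n = Matrix.diagonal ![2, 1] ∧
    (∀ k ≤ n, ∃ δ : ℝ, (ReducedTwist.complex n).IsSpectralGap k δ ∧ 1 ≤ δ) :=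
  ⟨⟨(TwistedUnknot.realization n).isComplex, (ReducedTwist.realization n).isComplex,
      (TwistedUnknot.realization n).gradedHomotopyEquivalent (ReducedTwist.realization n) _ _
        (codeRetract n)⟩,
    fun h => ReducedTwist.exists_unitary_pairLaplacian_zero h _,
    fun _ h₁ h₂ => ReducedTwist.pairLaplacian_eq h₁ h₂ _,
    fun h => ReducedTwist.pairLaplacian_pred h _,
    ReducedTwist.lastLaplacian_eq n,
    fun _ hk => ReducedTwist.exists_isSpectralGap n hk⟩
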